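/- Let $n\ge 2$ and let $\mathcal G$ be a strongly connected signed digraph on the nodes $v_1,\dots,v_n$, given by a real weight matrix $A=[a_{ij}]$ with $a_{ii}=0$ and $a_{ij}a_{ji}\ge 0$ for all $i,j$, where $(v_j,v_i)$ is an edge if and only if $a_{ij}\ne 0$. $\mathcal G$ is structurally balanced if the nodes split into two disjoint (possibly empty) sets such that $a_{ij}\ge 0$ for $v_i,v_j$ in the same set and $a_{ij}\le 0$ for $v_i,v_j$ in different sets; otherwise it is structurally unbalanced. The Laplacian matrix of a signed digraph with weights $a_{ij}$ is $L=\mathrm{diag}\big(\sum_j|a_{1j}|,\dots,\sum_j|a_{nj}|\big)-A$. Let $\overline L$ be the Laplacian matrix for the weights $|a_{ij}|$, let $\overline L_{ii}$ be $\overline L$ with its $i$th row and column removed, let the mirror signed graph $\hat{\mathcal G}$ be the undirected signed graph with weights $\hat a_{ij}=\tfrac12\big(\det(\overline L_{ii})a_{ij}+\det(\overline L_{jj})a_{ji}\big)$, and let $\hat L$ be its (symmetric) Laplacian matrix, with eigenvalues $\lambda_1(\hat L)\le\lambda_2(\hat L)\le\dots\le\lambda_n(\hat L)$. Consider the network $\dot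 x_i=u_i$, $x_i(0)=x_{i0}$, $i=1,\dots,n$, under the protocol $$u_i=k_1 g_i^{m/r}+k_2 g_i^{p/q},\qquad g_i=-\sum_{v_j\in \hat N(i)}|\hat a_{ij}|\big(x_i-\mathrm{sgn}(\hat a_{ij})x_j\big),$$ where $\hat N(i)=\{v_j:\hat a_{ij}\neq 0\}$, $k_1,k_2>0$, and $m,r,p,q$ are positive odd integers with $m>r$ and $q>p$ (odd powers and odd roots of negative numbers are the real ones). Then for every initial state $x_0=(x_{10},\dots,x_{n0})$ the network has a solution on $[0,\infty)$, and the following holds. 1. If $\mathcal G$ is structurally balanced, the network achieves fixed-time bipartite consensus: there are signs $\sigma_1,\dots,\sigma_n\in\{\pm1\}$ and a time $T\ge 0$, neither depending on $x_0$, and for every $x_0$ a real number $c=c(x_0)$, such that every solution starting at $x_0$ satisfies $\lim_{t\to T}x_i(t)=\sigma_i c$ and $x_i(t)=\sigma_i c$ for all $t\ge T$ and all $i$; here $c(x_0)\neq0$ except for degenerate initial states, of which there is exactly one on every line $\{x_0+a(\sigma_1,\dots,\sigma_n):a\in\mathbb R\}$; and $$T\le\frac1{\lambda_2(\hat L)}\left(\frac{n^{\frac{m-r}{2r}}}{k_1}\,\frac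 r{m-r}+\frac1{k_2}\,\frac q{q-p}\right).$$ 2. If $\mathcal G$ is structurally unbalanced, the network achieves fixed-time state stability: there is a time $T\ge0$, not depending on $x_0$, such that every solution, whatever its initial state, satisfies $\lim_{t\to T}x_i(t)=0$ and $x_i(t)=0$ for all $t\ge T$ and all $i$; and $$T\le\frac1{\lambda_1(\hat L)}\left(\frac{n^{\frac{m-r}{2r}}}{k_1}\,\frac r{m-r}+\frac1{k_2}\,\frac q{q-p}\right).$$ -/

import Mathlib

open Filter Topology

/-- A signed digraph on the nodes `v_0, …, v_{n-1}`, given by its adjacency weight matrix `A`;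
`(v_j, v_i)` is an edge iff `A i j ≠ 0`. There are no self-loops, and the digraph is digon
sign-symmetric. -/
structure SignedDigraph (n : ℕ) where
  A : Matrix (Fin n) (Fin n) ℝ
  no_loops : ∀ i, A i i = 0
  digon_sign_symmetric : ∀ i j, 0 ≤ A i j * A j i

namespace SignedDigraph

variable {n : ℕ}

/-- `G.Edge j i`: there is a directed edge from `v_j` to `v_i`. -/
def Edge (G : SignedDigraph n) (j i : Fin n) : Prop := G.A i j ≠ 0

open Classical in
/-- The set `N(i)` of the neighbors of `v_i`: all `v_j` from which there is an edge to `v_i`. -/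
noncomputable def neighbors (G : SignedDigraph n) (i : Fin n) : Finset (Fin n) :=
  Finset.univ.filter fun j => G.Edge j i

/-- There is a directed path from every node to every other node. -/
def StronglyConnected (G : SignedDigraph n) : Prop :=
  ∀ i j : Fin n, i ≠ j → Relation.TransGen G.Edge i j

/-- The nodes split into two disjoint sets (one of them may be empty) such that weights within a
set are nonnegative and weights between the two sets are nonpositive. -/
def StructurallyBalanced (G : SignedDigraph n) : Prop :=
  ∃ V₁ V₂ : Set (Fin n), V₁ ∪ V₂ = Set.univ ∧ Disjoint V₁ V₂ ∧
    (∀ i ∈ V₁, ∀ j ∈ V₁, 0 ≤ G.A i j) ∧ (∀ i ∈ V₂, ∀ j ∈ V₂, 0 ≤ G.A i j) ∧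
    (∀ i ∈ V₁, ∀ j ∈ V₂, G.A i j ≤ 0) ∧ (∀ i ∈ V₂, ∀ j ∈ V₁, G.A i j ≤ 0)

/-- A signed digraph that is not structurally balanced. -/
def StructurallyUnbalanced (G : SignedDigraph n) : Prop := ¬ G.StructurallyBalanced

/-- The in-degree of a node. -/
def inDegree (G : SignedDigraph n) (i : Fin n) : ℝ := ∑ j, |G.A i j|

/-- The Laplacian matrix `L = Δ - A`, where `Δ` is the in-degree matrix. -/
def laplacian (G : SignedDigraph n) : Matrix (Fin n) (Fin n) ℝ :=
  Matrix.diagonal G.inDegree - G.A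

/-- The induced unsigned digraph, with weights `|a_ij|`. -/
def inducedUnsigned (G : SignedDigraph n) : SignedDigraph n where
  A := Matrix.of fun i j => |G.A i j|
  no_loops i := by simp [G.no_loops i]
  digon_sign_symmetric i j := mul_nonneg (abs_nonneg _) (abs_nonneg _)

/-- `det (L̄_ii)`: the determinant of the Laplacian matrix of the induced unsigned digraph with its
`i`-th row and `i`-th column removed. -/
noncomputable def minorDet (G : SignedDigraph n) (i : Fin n) : ℝ :=
  (G.inducedUnsigned.laplacian.submatrix
    (Subtype.val : {j : Fin n // j ≠ i} → Fin n)
    (Subtype.val : {j : Fin n // j ≠ i} → Fin n)).det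

/-- The mirror signed graph, with the symmetric weights
`â_ij = (det (L̄_ii) a_ij + det (L̄_jj) a_ji) / 2`. -/
noncomputable def mirror (G : SignedDigraph n) : SignedDigraph n where
  A := Matrix.of fun i j => (G.minorDet i * G.A i j + G.minorDet j * G.A j i) / 2
  no_loops i := by simp [G.no_loops i]
  digon_sign_symmetric i j := by
    simp only [Matrix.of_apply]
    rw [add_comm (G.minorDet j * G.A j i)]
    exact mul_self_nonneg _

/-- The Laplacian matrix `L̂` of the mirror signed graph is symmetric. -/
theorem mirror_laplacian_isHermitian (G : SignedDigraph n) : G.mirror.laplacian.IsHermitian := by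
  ext i j
  rcases eq_or_ne i j with rfl | h
  · simp
  · simp [laplacian, mirror, Matrix.diagonal_apply_ne _ h, Matrix.diagonal_apply_ne _ h.symm,
      add_comm]

/-- The eigenvalues of `L̂`, counted with multiplicity, in ascending order: `G.mirrorEigenvalue 0`
is `λ₁(L̂)`, `G.mirrorEigenvalue 1` is `λ₂(L̂)`, and so on. (`eigenvalues₀` lists them in descending
order.) -/
noncomputable def mirrorEigenvalue (G : SignedDigraph n) (k : Fin n) : ℝ :=
  G.mirror_laplacian_isHermitian.eigenvalues₀ (Fin.cast (Fintype.card_fin n).symm k.rev)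

end SignedDigraph

/-- The real power `y ^ (a / b)` for odd positive integers `a` and `b`, that is, the `a`-th power of
the real `b`-th root of `y`; it equals `sgn(y) |y| ^ (a / b)`. -/
noncomputable def oddPow (y : ℝ) (a b : ℕ) : ℝ := Real.sign y * |y| ^ ((a : ℝ) / (b : ℝ))

namespace SignedDigraph

variable {n : ℕ}

/-- `-∑ |â_ij| (x_i - sgn(â_ij) x_j)`, summed over the neighbors `v_j` of `v_i` in the mirror signed
graph. -/
noncomputable def mirrorFeedback (G : SignedDigraph n) (x : Fin n → ℝ) (i : Fin n) : ℝ :=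
  -∑ j ∈ G.mirror.neighbors i, |G.mirror.A i j| * (x i - Real.sign (G.mirror.A i j) * x j)

/-- The nonlinear protocol
`u_i = k₁ (mirrorFeedback_i) ^ (m / r) + k₂ (mirrorFeedback_i) ^ (p / q)`. -/
noncomputable def protocol (G : SignedDigraph n) (k₁ k₂ : ℝ) (m r p q : ℕ)
    (x : Fin n → ℝ) (i : Fin n) : ℝ :=
  k₁ * oddPow (G.mirrorFeedback x i) m r + k₂ * oddPow (G.mirrorFeedback x i) p q

end SignedDigraph

/-- `x` is a trajectory on `[0, ∞)`, with initial state `x₀`, of the network of single integrators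
`ẋ_i = u_i` under the state feedback `u`. -/
def IsTrajectory {n : ℕ} (u : (Fin n → ℝ) → Fin n → ℝ) (x₀ : Fin n → ℝ)
    (x : ℝ → Fin n → ℝ) : Prop :=
  x 0 = x₀ ∧ ∀ t, 0 ≤ t → ∀ i, HasDerivWithinAt (fun s => x s i) (u (x t) i) (Set.Ici 0) t

/-- On `[0, ∞)` the function `x` tends to `y` at time `T` and is equal to `y` from time `T` on. -/
def SettlesAt {n : ℕ} (x : ℝ → Fin n → ℝ) (T : ℝ) (y : Fin n → ℝ) : Prop :=
  ∀ i, Tendsto (fun t => x t i) (𝓝[Set.Ici 0] T) (𝓝 (y i)) ∧ ∀ t, T ≤ t → x t i = y i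

/-- Fixed-time bipartite consensus with the setting time `T`, which does not depend on the initial
state `x₀`: the network has a trajectory from every `x₀`, and every trajectory from `x₀` settles at
`c(x₀) (σ_1, …, σ_n)` at time `T`. The value `c(x₀)` is nonzero except for degenerate initial states
(such as `x₀ = 0`), exactly one on each line in the direction `(σ_1, …, σ_n)`. -/
def FixedTimeBipartiteConsensus {n : ℕ} (u : (Fin n → ℝ) → Fin n → ℝ) (T : ℝ) : Prop :=
  ∃ (σ : Fin n → ℝ) (c : (Fin n → ℝ) → ℝ),
    (∀ i, σ i = 1 ∨ σ i = -1) ∧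
    (∀ x₀, (∃ x, IsTrajectory u x₀ x) ∧
      ∀ x, IsTrajectory u x₀ x → SettlesAt x T (fun i => σ i * c x₀)) ∧
    (∀ x₀, ∃! a : ℝ, c (x₀ + a • σ) = 0)

/-- Fixed-time state stability with the setting time `T`, which does not depend on the initial
state `x₀`: the network has a trajectory from every `x₀`, and every trajectory settles at `0` at
time `T`. -/
def FixedTimeStateStability {n : ℕ} (u : (Fin n → ℝ) → Fin n → ℝ) (T : ℝ) : Prop :=
  ∀ x₀, (∃ x, IsTrajectory u x₀ x) ∧ ∀ x, IsTrajectory u x₀ x → SettlesAt x T 0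

/-! The feedback of the protocol is `-L x`, where `L` is the Laplacian of the mirror graph, so the
network is `ẋ = F (-L x)` with `F y = k₁ y ^ (m / r) + k₂ y ^ (p / q)` acting on each coordinate;
`F` is continuous and increasing, but not Lipschitz.

*Graph.* In a strongly connected graph the reduced Laplacians have positive determinant
(`SignedDigraph.minorDet_pos`: diagonal dominance and the maximum principle). So the mirror graph
has an edge wherever the digraph has one, with the same sign, and its Laplacian `L` is positive
semidefinite. The entries of a nonzero kernel vector have equal modulus, and their signs balance
the graph. Hence the kernel is spanned by the balancing signs `σ` in the balanced case and is `0`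
in the unbalanced case. The smallest nonzero eigenvalue `c`, which is `λ₂` or `λ₁`, is therefore
positive and satisfies `c xᵀ L x ≤ |L x|²` (`mul_energy_le_of_eigenvalues`).

*Settling.* Along a solution the derivative of `W = c xᵀ L x` is `2 c (L x) · F (-L x)`. With the
power mean inequality this gives `W' ≤ -(a W ^ s₁ + b W ^ s₂)` for some `s₂ < 1 < s₁`, and such a
`W` vanishes after a time independent of `W 0` (`eq_zero_of_deriv_le_neg_rpow_add_rpow`), which is
exactly the claimed bound. From then on `L x = 0`, so the state is at rest.

*Uniqueness and existence.* As `F` is increasing, `xᵀ L x` decreases along the difference of two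
solutions. This gives uniqueness (`eqOn_of_hasDerivWithinAt_feedbackField`), so the consensus
value `c(x₀)` is well defined. The same estimate shows that the solutions for Lipschitz
approximations of `F` converge after applying `L`, hence that a solution exists
(`exists_hasDerivWithinAt_Ici_feedbackField`).

*Degenerate states.* As `L σ = 0`, translating a trajectory by `a σ` gives a trajectory, so
`c(x₀ + a σ) = c(x₀) + a`, which vanishes for exactly one `a`. -/

/-! ### A scalar differential inequality -/

/-- A nonnegative function with `W' ≤ -(a W ^ s₁ + b W ^ s₂)`, where `s₂ < 1 < s₁`, vanishes after a
time that does not depend on `W 0`: the superlinear term brings `W` below `1` by the time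
`1 / (a (s₁ - 1))`, and the sublinear term then brings it to `0` within `1 / (b (1 - s₂))`. -/
theorem eq_zero_of_deriv_le_neg_rpow_add_rpow {W W' : ℝ → ℝ} {a b s₁ s₂ : ℝ} (ha : 0 < a)
    (hb : 0 < b) (hs₁ : 1 < s₁) (hs₂ : s₂ < 1)
    (hW : ∀ t, 0 ≤ t → HasDerivWithinAt W (W' t) (Set.Ici 0) t) (hnn : ∀ t, 0 ≤ t → 0 ≤ W t)
    (hle : ∀ t, 0 ≤ t → W' t ≤ -(a * W t ^ s₁ + b * W t ^ s₂)) {t : ℝ}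
    (ht : 1 / (a * (s₁ - 1)) + 1 / (b * (1 - s₂)) ≤ t) : W t = 0 := by
  set T₁ := 1 / (a * (s₁ - 1)) with hT₁
  set T₂ := 1 / (b * (1 - s₂)) with hT₂
  have h1 : 0 < a * (s₁ - 1) := mul_pos ha (by linarith)
  have h2 : 0 < b * (1 - s₂) := mul_pos hb (by linarith)
  have hT₁pos : 0 < T₁ := by positivity
  have hT₂pos : 0 < T₂ := by positivity
  have hcont : ContinuousOn W (Set.Ici 0) := fun s hs => (hW s hs).continuousWithinAt
  have hWat : ∀ s, 0 < s → HasDerivAt W (W' s) s := fun s hs =>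
    (hW s hs.le).hasDerivAt (Ici_mem_nhds hs)
  have hanti : AntitoneOn W (Set.Ici 0) := by
    refine antitoneOn_of_hasDerivWithinAt_nonpos (f' := W') (convex_Ici 0) hcont ?_ ?_
    · intro s hs
      rw [interior_Ici] at hs
      exact (hWat s hs).hasDerivWithinAt
    · intro s hs
      rw [interior_Ici] at hs
      have hs' : 0 ≤ s := le_of_lt hs
      have := Real.rpow_nonneg (hnn s hs') s₁
      have := Real.rpow_nonneg (hnn s hs') s₂
      have := hle s hs'
      nlinarith [mul_nonneg ha.le (Real.rpow_nonneg (hnn s hs') s₁),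
        mul_nonneg hb.le (Real.rpow_nonneg (hnn s hs') s₂)]
  by_contra hne
  have ht0 : 0 ≤ t := by linarith
  have hWt : 0 < W t := lt_of_le_of_ne (hnn t ht0) (Ne.symm hne)
  have hpos : ∀ s ∈ Set.Icc 0 t, 0 < W s := fun s hs =>
    hWt.trans_le (hanti hs.1 ht0 hs.2)
  have hcont' : ContinuousOn W (Set.Icc 0 t) := hcont.mono Set.Icc_subset_Ici_self
  have hpow : ∀ e : ℝ, ContinuousOn (fun s => W s ^ e) (Set.Icc 0 t) := fun e =>
    hcont'.rpow_const fun s hs => Or.inl (hpos s hs).ne'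
  have hderiv : ∀ e c : ℝ, ∀ s ∈ interior (Set.Icc 0 t),
      HasDerivWithinAt (fun s => W s ^ e + c * s) (W' s * e * W s ^ (e - 1) + c)
        (interior (Set.Icc 0 t)) s := by
    intro e c s hs
    rw [interior_Icc] at hs ⊢
    have := ((hWat s hs.1).rpow_const (p := e) (Or.inl (hpos s ⟨hs.1.le, hs.2.le⟩).ne')).add
      ((hasDerivAt_id s).const_mul c)
    simpa using! this.hasDerivWithinAt
  -- `W ^ (1 - s₁)` grows at least at the rate `a (s₁ - 1)`.
  have hmono : MonotoneOn (fun s => W s ^ (1 - s₁) + (-(a * (s₁ - 1))) * s) (Set.Icc 0 t) := by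
    refine monotoneOn_of_hasDerivWithinAt_nonneg (convex_Icc 0 t)
      ((hpow _).add (by fun_prop)) (hderiv _ _) ?_
    intro s hs
    rw [interior_Icc] at hs
    have hp := hpos s ⟨hs.1.le, hs.2.le⟩
    have hl := hle s hs.1.le
    have e1 : W s ^ s₁ * W s ^ (1 - s₁ - 1) = 1 := by
      rw [← Real.rpow_add hp]; simp
    have hq : 0 < W s ^ (1 - s₁ - 1) := Real.rpow_pos_of_pos hp _
    have hl' : W' s ≤ -(a * W s ^ s₁) := by
      have := mul_nonneg hb.le (Real.rpow_nonneg hp.le s₂); linarith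
    have h3 : W' s * W s ^ (1 - s₁ - 1) ≤ -a := by
      calc _ ≤ -(a * W s ^ s₁) * W s ^ (1 - s₁ - 1) := by gcongr
        _ = -a * (W s ^ s₁ * W s ^ (1 - s₁ - 1)) := by ring
        _ = -a := by rw [e1]; ring
    nlinarith
  -- `W ^ (1 - s₂)` decreases at least at the rate `b (1 - s₂)`.
  have hanti2 : AntitoneOn (fun s => W s ^ (1 - s₂) + (b * (1 - s₂)) * s) (Set.Icc 0 t) := by
    refine antitoneOn_of_hasDerivWithinAt_nonpos (convex_Icc 0 t)
      ((hpow _).add (by fun_prop)) (hderiv _ _) ?_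
    intro s hs
    rw [interior_Icc] at hs
    have hp := hpos s ⟨hs.1.le, hs.2.le⟩
    have hl := hle s hs.1.le
    have e1 : W s ^ s₂ * W s ^ (1 - s₂ - 1) = 1 := by
      rw [← Real.rpow_add hp]; simp
    have hq : 0 < W s ^ (1 - s₂ - 1) := Real.rpow_pos_of_pos hp _
    have hl' : W' s ≤ -(b * W s ^ s₂) := by
      have := mul_nonneg ha.le (Real.rpow_nonneg hp.le s₁); linarith
    have h3 : W' s * W s ^ (1 - s₂ - 1) ≤ -b := by
      calc _ ≤ -(b * W s ^ s₂) * W s ^ (1 - s₂ - 1) := by gcongr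
        _ = -b * (W s ^ s₂ * W s ^ (1 - s₂ - 1)) := by ring
        _ = -b := by rw [e1]; ring
    nlinarith
  have hm1 : (0 : ℝ) ∈ Set.Icc 0 t := ⟨le_rfl, ht0⟩
  have hm2 : T₁ ∈ Set.Icc 0 t := ⟨hT₁pos.le, by linarith⟩
  have hm3 : t ∈ Set.Icc 0 t := ⟨ht0, le_rfl⟩
  have k1 := hmono hm1 hm2 hT₁pos.le
  have k2 := hanti2 hm2 hm3 hm2.2
  have e3 : a * (s₁ - 1) * T₁ = 1 := mul_one_div_cancel h1.ne'
  have e4 : b * (1 - s₂) * T₂ = 1 := mul_one_div_cancel h2.ne'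
  simp only at k1 k2
  have hW1 : W T₁ < 1 := by
    by_contra hge
    push Not at hge
    have := Real.rpow_le_one_of_one_le_of_nonpos hge (show 1 - s₁ ≤ 0 by linarith)
    have := Real.rpow_pos_of_pos (hpos 0 hm1) (1 - s₁)
    linarith
  have hW2 : W T₁ ^ (1 - s₂) < 1 := Real.rpow_lt_one (hnn _ hT₁pos.le) hW1 (by linarith)
  have hW3 := Real.rpow_pos_of_pos hWt (1 - s₂)
  have : b * (1 - s₂) * (T₁ + T₂) ≤ b * (1 - s₂) * t := by gcongr
  linarith

/-! ### Odd powers -/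

lemma oddPow_zero (a b : ℕ) : oddPow 0 a b = 0 := by simp [oddPow]

lemma oddPow_neg (y : ℝ) (a b : ℕ) : oddPow (-y) a b = -oddPow y a b := by
  simp [oddPow, Real.sign_neg]

lemma oddPow_of_nonneg {y : ℝ} (hy : 0 ≤ y) {a b : ℕ} (ha : 0 < a) (hb : 0 < b) :
    oddPow y a b = y ^ ((a : ℝ) / b) := by
  have : ((a : ℝ) / b) ≠ 0 := by positivity
  rcases hy.eq_or_lt with rfl | h
  · simp [oddPow, Real.zero_rpow this]
  · simp [oddPow, Real.sign_of_pos h, abs_of_pos h]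

lemma oddPow_of_nonpos {y : ℝ} (hy : y ≤ 0) {a b : ℕ} (ha : 0 < a) (hb : 0 < b) :
    oddPow y a b = -(-y) ^ ((a : ℝ) / b) := by
  rw [← oddPow_of_nonneg (neg_nonneg.2 hy) ha hb, oddPow_neg, neg_neg]

lemma monotone_oddPow {a b : ℕ} (ha : 0 < a) (hb : 0 < b) : Monotone fun y => oddPow y a b := by
  have he : 0 ≤ (a : ℝ) / b := by positivity
  intro x y hxy
  simp only
  rcases le_total 0 x with hx | hx
  · rw [oddPow_of_nonneg hx ha hb, oddPow_of_nonneg (hx.trans hxy) ha hb]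
    exact Real.rpow_le_rpow hx hxy he
  · rcases le_total 0 y with hy | hy
    · rw [oddPow_of_nonpos hx ha hb, oddPow_of_nonneg hy ha hb]
      have := Real.rpow_nonneg (neg_nonneg.2 hx) ((a : ℝ) / b)
      have := Real.rpow_nonneg hy ((a : ℝ) / b)
      linarith
    · rw [oddPow_of_nonpos hx ha hb, oddPow_of_nonpos hy ha hb]
      exact neg_le_neg (Real.rpow_le_rpow (neg_nonneg.2 hy) (neg_le_neg hxy) he)

lemma continuous_oddPow {a b : ℕ} (ha : 0 < a) (hb : 0 < b) :
    Continuous fun y => oddPow y a b := by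
  have he : 0 < (a : ℝ) / b := by positivity
  have : (fun y => oddPow y a b) =
      fun y => (max y 0) ^ ((a : ℝ) / b) - (max (-y) 0) ^ ((a : ℝ) / b) := by
    funext y
    rcases le_total 0 y with hy | hy
    · rw [oddPow_of_nonneg hy ha hb, max_eq_left hy, max_eq_right (neg_nonpos.2 hy),
        Real.zero_rpow he.ne', sub_zero]
    · rw [oddPow_of_nonpos hy ha hb, max_eq_right hy, max_eq_left (neg_nonneg.2 hy),
        Real.zero_rpow he.ne', zero_sub]
  rw [this]
  exact ((continuous_id.max continuous_const).rpow_const fun _ => Or.inr he.le).sub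
    ((continuous_neg.max continuous_const).rpow_const fun _ => Or.inr he.le)

lemma mul_oddPow {a b : ℕ} (ha : 0 < a) (hb : 0 < b) (y : ℝ) :
    y * oddPow y a b = (y ^ 2) ^ (((a : ℝ) + b) / (2 * b)) := by
  have he : 0 < (a : ℝ) / b := by positivity
  have hb' : (b : ℝ) ≠ 0 := by positivity
  have key : ∀ z : ℝ, 0 ≤ z → z * z ^ ((a : ℝ) / b) = (z ^ 2) ^ (((a : ℝ) + b) / (2 * b)) := by
    intro z hz
    have h1 : z * z ^ ((a : ℝ) / b) = z ^ (1 + (a : ℝ) / b) := by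
      rw [Real.rpow_add_of_nonneg hz zero_le_one he.le, Real.rpow_one]
    rw [h1, ← Real.rpow_natCast, ← Real.rpow_mul hz]
    congr 1
    push_cast
    field_simp
    ring
  rcases le_total 0 y with hy | hy
  · rw [oddPow_of_nonneg hy ha hb, key y hy]
  · rw [oddPow_of_nonpos hy ha hb, ← neg_sq, ← key (-y) (neg_nonneg.2 hy)]
    ring

/-- The subadditivity of concave powers, for finite sums. -/
lemma Real.rpow_sum_le_sum_rpow {ι : Type*} (s : Finset ι) {f : ι → ℝ} (hf : ∀ i, 0 ≤ f i) {e : ℝ}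
    (he : 0 < e) (he1 : e ≤ 1) : (∑ i ∈ s, f i) ^ e ≤ ∑ i ∈ s, f i ^ e := by
  classical
  induction s using Finset.induction_on with
  | empty => simp [Real.zero_rpow he.ne']
  | insert i s hi ih =>
    rw [Finset.sum_insert hi, Finset.sum_insert hi]
    exact (Real.rpow_add_le_add_rpow (hf i) (Finset.sum_nonneg fun j _ => hf j) he.le he1).trans
      (by gcongr)

/-! ### Monotone feedback of the gradient of a quadratic form -/

section Feedback

open Matrix

variable {ι : Type*} [Fintype ι]

/-- The quadratic form `x ↦ xᵀ L x`. -/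
def energy (L : Matrix ι ι ℝ) (x : ι → ℝ) : ℝ := x ⬝ᵥ (L *ᵥ x)

/-- The vector field `x ↦ F (-L x)`, where `F` acts on each coordinate. -/
def feedbackField (L : Matrix ι ι ℝ) (F : ℝ → ℝ) (x : ι → ℝ) (i : ι) : ℝ := F (-(L *ᵥ x) i)

lemma energy_nonneg {L : Matrix ι ι ℝ} (hL : L.PosSemidef) (x : ι → ℝ) : 0 ≤ energy L x := by
  simpa [energy] using hL.dotProduct_mulVec_nonneg x

lemma dotProduct_mulVec_comm {L : Matrix ι ι ℝ} (hL : L.IsHermitian) (x y : ι → ℝ) :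
    x ⬝ᵥ (L *ᵥ y) = y ⬝ᵥ (L *ᵥ x) := by
  have h : Lᵀ = L := by simpa [Matrix.IsHermitian, conjTranspose_eq_transpose_of_trivial] using hL
  rw [dotProduct_mulVec, ← mulVec_transpose, h, dotProduct_comm]

lemma energy_add_smul {L : Matrix ι ι ℝ} (hL : L.IsHermitian) (x y : ι → ℝ) (t : ℝ) :
    energy L (x + t • y) = energy L y * (t * t) + 2 * (y ⬝ᵥ (L *ᵥ x)) * t + energy L x := by
  simp only [energy, mulVec_add, mulVec_smul, add_dotProduct, dotProduct_add, smul_dotProduct,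
    dotProduct_smul, smul_eq_mul, dotProduct_mulVec_comm hL x y]
  ring

/-- The Cauchy–Schwarz inequality for the form `energy L` and a coordinate vector. -/
lemma sq_mulVec_le [DecidableEq ι] {L : Matrix ι ι ℝ} (hL : L.PosSemidef) (x : ι → ℝ) (i : ι) :
    (L *ᵥ x) i ^ 2 ≤ L i i * energy L x := by
  have h := discrim_le_zero (a := energy L (Pi.single i 1))
    (b := 2 * (Pi.single i 1 ⬝ᵥ (L *ᵥ x))) (c := energy L x) fun t => by
      rw [← energy_add_smul hL.isHermitian]; exact energy_nonneg hL _
  simp only [discrim, energy, single_one_dotProduct, mulVec_single_one, col_apply] at h ⊢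
  linarith

lemma hasDerivWithinAt_energy {L : Matrix ι ι ℝ} (hL : L.IsHermitian) {x : ℝ → ι → ℝ} {x' : ι → ℝ}
    {s : Set ℝ} {t : ℝ} (hx : HasDerivWithinAt x x' s t) :
    HasDerivWithinAt (fun t => energy L (x t)) (2 * ((L *ᵥ x t) ⬝ᵥ x')) s t := by
  have hLx : HasDerivWithinAt (fun t => L *ᵥ x t) (L *ᵥ x') s t :=
    (L.mulVecLin.toContinuousLinearMap.hasFDerivAt (x := x t)).comp_hasDerivWithinAt t hx
  rw [hasDerivWithinAt_pi] at hx hLx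
  have h := HasDerivWithinAt.fun_sum (u := Finset.univ) fun i _ => (hx i).mul (hLx i)
  refine h.congr_deriv ?_
  rw [Finset.sum_add_distrib]
  change x' ⬝ᵥ (L *ᵥ x t) + x t ⬝ᵥ (L *ᵥ x') = _
  rw [dotProduct_mulVec_comm hL (x t), ← two_mul, dotProduct_comm]

lemma continuous_mulVec (L : Matrix ι ι ℝ) : Continuous fun x : ι → ℝ => L *ᵥ x :=
  L.mulVecLin.continuous_of_finiteDimensional

lemma continuous_feedbackField (L : Matrix ι ι ℝ) {F : ℝ → ℝ} (hF : Continuous F) :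
    Continuous (feedbackField L F) :=
  continuous_pi fun i => hF.comp ((continuous_apply i).comp (continuous_mulVec L)).neg

/-- For a monotone feedback the form `energy L` of the difference of two solutions decreases, so it
stays `0`. Hence `L` takes the same values along both solutions, and so does the vector field. No
Lipschitz condition on `F` is needed. -/
theorem eqOn_of_hasDerivWithinAt_feedbackField {L : Matrix ι ι ℝ} (hL : L.PosSemidef) {F : ℝ → ℝ}
    (hF : Monotone F) {τ : ℝ} {x y : ℝ → ι → ℝ}
    (hx : ∀ t ∈ Set.Icc 0 τ, HasDerivWithinAt x (feedbackField L F (x t)) (Set.Icc 0 τ) t)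
    (hy : ∀ t ∈ Set.Icc 0 τ, HasDerivWithinAt y (feedbackField L F (y t)) (Set.Icc 0 τ) t)
    (hxy : x 0 = y 0) : Set.EqOn x y (Set.Icc 0 τ) := by
  classical
  have hd : ∀ t ∈ Set.Icc 0 τ, HasDerivWithinAt (fun t => x t - y t)
      (feedbackField L F (x t) - feedbackField L F (y t)) (Set.Icc 0 τ) t :=
    fun t ht => (hx t ht).sub (hy t ht)
  have hE := fun t ht => hasDerivWithinAt_energy hL.isHermitian (hd t ht)
  have hanti : AntitoneOn (fun t => energy L (x t - y t)) (Set.Icc 0 τ) := by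
    refine antitoneOn_of_hasDerivWithinAt_nonpos (convex_Icc 0 τ)
      (fun t ht => (hE t ht).continuousWithinAt)
      (fun t ht => (hE t (interior_subset ht)).mono interior_subset) fun t _ => ?_
    refine mul_nonpos_of_nonneg_of_nonpos zero_le_two (Finset.sum_nonpos fun i _ => ?_)
    simp only [mulVec_sub, Pi.sub_apply, feedbackField]
    rcases le_total ((L *ᵥ x t) i) ((L *ᵥ y t) i) with h | h
    · exact mul_nonpos_of_nonpos_of_nonneg (sub_nonpos.2 h)
        (sub_nonneg.2 (hF (neg_le_neg h)))
    · exact mul_nonpos_of_nonneg_of_nonpos (sub_nonneg.2 h)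
        (sub_nonpos.2 (hF (neg_le_neg h)))
  have hfield : ∀ t ∈ Set.Icc 0 τ, feedbackField L F (x t) = feedbackField L F (y t) := by
    intro t ht
    have h0 : energy L (x t - y t) ≤ 0 := by
      simpa [hxy, energy] using hanti ⟨le_rfl, ht.1.trans ht.2⟩ ht ht.1
    funext i
    have h1 := sq_mulVec_le hL (x t - y t) i
    rw [le_antisymm h0 (energy_nonneg hL _), mul_zero] at h1
    have h2 := pow_eq_zero_iff two_ne_zero |>.1 (le_antisymm h1 (sq_nonneg _))
    rw [mulVec_sub, Pi.sub_apply, sub_eq_zero] at h2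
    simp only [feedbackField, h2]
  intro t ht
  have hconst := constant_of_has_deriv_right_zero (f := fun t => x t - y t) (a := 0) (b := τ)
    (fun s hs => (hd s hs).continuousWithinAt) fun s hs => by
      have h := hd s ⟨hs.1, hs.2.le⟩
      rw [hfield s ⟨hs.1, hs.2.le⟩, sub_self] at h
      exact h.mono_of_mem_nhdsWithin (Icc_mem_nhdsGE_of_mem hs)
  have := hconst t ht
  simp only [hxy, sub_self] at this
  exact sub_eq_zero.1 this

/-- A uniformly continuous monotone function is a uniform limit of Lipschitz monotone ones, its
moving averages. -/
lemma exists_lipschitzWith_monotone_approx {F : ℝ → ℝ} (hF : Monotone F)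
    (huc : UniformContinuous F) {ε : ℝ} (hε : 0 < ε) :
    ∃ (G : ℝ → ℝ) (K : NNReal), Monotone G ∧ LipschitzWith K G ∧ ∀ s, |G s - F s| ≤ ε := by
  obtain ⟨δ, hδ, hδF⟩ := Metric.uniformContinuous_iff.1 huc ε hε
  set d := δ / 2 with hd
  have hdpos : 0 < d := by positivity
  have hdF : ∀ s c, s ≤ c → c ≤ s + d → |F c - F s| ≤ ε := fun s c h1 h2 => by
    refine (hδF (a := c) (b := s) ?_).le
    rw [Real.dist_eq, abs_of_nonneg (by linarith)]
    linarith
  set P : ℝ → ℝ := fun s => ∫ t in (0 : ℝ)..s, F t with hP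
  have hPd : ∀ s, HasDerivAt P (F s) s := fun s =>
    intervalIntegral.integral_hasDerivAt_right (huc.continuous.intervalIntegrable _ _)
      (huc.continuous.stronglyMeasurableAtFilter _ _) huc.continuous.continuousAt
  have hGd : ∀ s, HasDerivAt (fun s => (P (s + d) - P s) / d) ((F (s + d) - F s) / d) s :=
    fun s => (((hPd (s + d)).comp_add_const s d).sub (hPd s)).div_const d
  refine ⟨fun s => (P (s + d) - P s) / d, (ε / d).toNNReal, ?_, ?_, ?_⟩
  · refine monotone_of_deriv_nonneg (fun s => (hGd s).differentiableAt) fun s => ?_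
    rw [(hGd s).deriv]
    exact div_nonneg (sub_nonneg.2 (hF (by linarith))) hdpos.le
  · refine lipschitzWith_of_nnnorm_deriv_le (fun s => (hGd s).differentiableAt) fun s => ?_
    rw [(hGd s).deriv, ← NNReal.coe_le_coe, coe_nnnorm, Real.coe_toNNReal _ (by positivity),
      norm_div, Real.norm_eq_abs, Real.norm_of_nonneg hdpos.le]
    gcongr
    exact hdF s (s + d) (by linarith) le_rfl
  · intro s
    obtain ⟨c, hc, hcs⟩ := exists_hasDerivAt_eq_slope P F (show s < s + d by linarith)
      (fun t _ => (hPd t).continuousAt.continuousWithinAt) fun t _ => hPd t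
    rw [add_sub_cancel_left] at hcs
    simp only [← hcs]
    exact hdF s c hc.1.le hc.2.le

lemma exists_lipschitzWith_feedbackField (L : Matrix ι ι ℝ) {F : ℝ → ℝ} {K : NNReal}
    (hF : LipschitzWith K F) : ∃ K', LipschitzWith K' (feedbackField L F) := by
  have h1 : LipschitzWith K fun (y : ι → ℝ) i => F (-y i) := by
    refine LipschitzWith.of_dist_le_mul fun y z => ?_
    rw [dist_pi_le_iff (by positivity)]
    intro i
    refine (hF.dist_le_mul _ _).trans ?_
    rw [dist_neg_neg]
    gcongr
    exact dist_le_pi_dist y z i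
  exact ⟨_, h1.comp L.mulVecLin.toContinuousLinearMap.lipschitz⟩

lemma norm_feedbackField_le (L : Matrix ι ι ℝ) {F : ℝ → ℝ} {M : ℝ} (hM : ∀ s, |F s| ≤ M)
    (x : ι → ℝ) : ‖feedbackField L F x‖ ≤ M :=
  (pi_norm_le_iff_of_nonneg ((abs_nonneg _).trans (hM 0))).2 fun _ => hM _

/-- The global form of the Picard–Lindelöf theorem for a bounded Lipschitz vector field. -/
lemma exists_eq_integral_of_lipschitzWith {E : Type*} [NormedAddCommGroup E] [NormedSpace ℝ E]
    [CompleteSpace E] {v : E → E} {K : NNReal} (hv : LipschitzWith K v) {M : ℝ}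
    (hM : ∀ x, ‖v x‖ ≤ M) {τ : ℝ} (hτ : 0 ≤ τ) (x₀ : E) :
    ∃ x : ℝ → E, x 0 = x₀ ∧
      (∀ t ∈ Set.Icc 0 τ, HasDerivWithinAt x (v (x t)) (Set.Icc 0 τ) t) ∧
      ∀ t ∈ Set.Icc 0 τ, x t = x₀ + ∫ s in (0 : ℝ)..t, v (x s) := by
  have hM0 : 0 ≤ M := (norm_nonneg _).trans (hM 0)
  have hPL : IsPicardLindelof (fun _ => v) (tmin := 0) (tmax := τ) ⟨0, le_rfl, hτ⟩ x₀
      (M * τ).toNNReal 0 M.toNNReal K := by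
    refine IsPicardLindelof.of_time_independent (fun x _ => ?_) hv.lipschitzOnWith ?_
    · rw [Real.coe_toNNReal _ hM0]; exact hM x
    · rw [Real.coe_toNNReal _ hM0, Real.coe_toNNReal _ (by positivity)]
      simp [hτ]
  obtain ⟨x, hx0, hx⟩ := hPL.exists_eq_forall_mem_Icc_hasDerivWithinAt₀
  refine ⟨x, hx0, hx, fun t ht => ?_⟩
  have := ODE.picard_eq_of_hasDerivAt (f := fun _ => v) (α := x) (t₀ := 0) (t := t)
    (u := Set.univ) (hv.continuous.comp continuous_snd).continuousOn
    (fun s hs => by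
      rw [Set.uIcc_of_le ht.1] at hs ⊢
      exact (hx s ⟨hs.1, hs.2.trans ht.2⟩).mono (Set.Icc_subset_Icc_right ht.2))
    (Set.mapsTo_univ _ _)
  have hx0' : x 0 = x₀ := hx0
  rw [← this, hx0']
  rfl

end Feedback

/-! ### Existence of solutions -/

section Existence

open Matrix

variable {ι : Type*} [Fintype ι]

/-- Solutions `x`, `y` of the equations with the monotone feedback `F` replaced by feedbacks `G`,
`H` that are `ε`- and `δ`-close to it: the energy of their difference is at most proportional to
`ε + δ`. -/
lemma energy_sub_le_of_approx {L : Matrix ι ι ℝ} (hL : L.PosSemidef) {F G H : ℝ → ℝ}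
    (hF : Monotone F) {ε δ : ℝ} (hG : ∀ s, |G s - F s| ≤ ε) (hH : ∀ s, |H s - F s| ≤ δ)
    {τ B : ℝ} {x y : ℝ → ι → ℝ}
    (hx : ∀ t ∈ Set.Icc 0 τ, HasDerivWithinAt x (feedbackField L G (x t)) (Set.Icc 0 τ) t)
    (hy : ∀ t ∈ Set.Icc 0 τ, HasDerivWithinAt y (feedbackField L H (y t)) (Set.Icc 0 τ) t)
    (hxy : x 0 = y 0) (hB : ∀ t ∈ Set.Icc 0 τ, ∀ i, |(L *ᵥ (x t - y t)) i| ≤ B) :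
    ∀ t ∈ Set.Icc 0 τ, energy L (x t - y t) ≤ 2 * (Fintype.card ι * (B * (ε + δ))) * τ := by
  have hε : 0 ≤ ε := (abs_nonneg _).trans (hG 0)
  have hδ : 0 ≤ δ := (abs_nonneg _).trans (hH 0)
  set C := 2 * (Fintype.card ι * (B * (ε + δ))) with hC
  have hE := fun t ht => hasDerivWithinAt_energy hL.isHermitian ((hx t ht).sub (hy t ht))
  have hanti : AntitoneOn (fun t => energy L (x t - y t) - C * t) (Set.Icc 0 τ) := by
    have hd : ∀ t ∈ Set.Icc 0 τ, HasDerivWithinAt (fun t => energy L (x t - y t) - C * t)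
        (2 * ((L *ᵥ (x t - y t)) ⬝ᵥ (feedbackField L G (x t) - feedbackField L H (y t))) - C * 1)
        (Set.Icc 0 τ) t :=
      fun t ht => (hE t ht).sub ((hasDerivWithinAt_id t _).const_mul C)
    refine antitoneOn_of_hasDerivWithinAt_nonpos (convex_Icc 0 τ)
      (fun t ht => (hd t ht).continuousWithinAt)
      (fun t ht => (hd t (interior_subset ht)).mono interior_subset) fun t ht => ?_
    have hsum : (L *ᵥ (x t - y t)) ⬝ᵥ (feedbackField L G (x t) - feedbackField L H (y t)) ≤
        ∑ _i : ι, B * (ε + δ) := by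
      refine Finset.sum_le_sum fun i _ => ?_
      have hBi := hB t (interior_subset ht) i
      simp only [mulVec_sub, Pi.sub_apply, feedbackField] at hBi ⊢
      set a := (L *ᵥ x t) i
      set b := (L *ᵥ y t) i
      have h1 : (a - b) * (F (-a) - F (-b)) ≤ 0 := by
        rcases le_total a b with h | h
        · exact mul_nonpos_of_nonpos_of_nonneg (sub_nonpos.2 h) (sub_nonneg.2 (hF (neg_le_neg h)))
        · exact mul_nonpos_of_nonneg_of_nonpos (sub_nonneg.2 h) (sub_nonpos.2 (hF (neg_le_neg h)))
      have h2 : (a - b) * ((G (-a) - F (-a)) - (H (-b) - F (-b))) ≤ B * (ε + δ) := by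
        refine (le_abs_self _).trans ?_
        rw [abs_mul]
        have := abs_sub (G (-a) - F (-a)) (H (-b) - F (-b))
        have := hG (-a)
        have := hH (-b)
        exact mul_le_mul hBi (by linarith) (abs_nonneg _) ((abs_nonneg _).trans hBi)
      linarith
    rw [Finset.sum_const, Finset.card_univ, nsmul_eq_mul] at hsum
    linarith
  intro t ht
  have hτ : 0 ≤ τ := ht.1.trans ht.2
  have h0 := hanti ⟨le_rfl, hτ⟩ ht ht.1
  have hz : energy L (x 0 - y 0) = 0 := by simp [hxy, energy]
  simp only [hz] at h0
  have hC0 : 0 ≤ C := by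
    rcases isEmpty_or_nonempty ι with h | ⟨⟨i⟩⟩
    · simp [hC]
    · have : 0 ≤ B := (abs_nonneg _).trans (hB t ht i)
      positivity
  have : C * t ≤ C * τ := by gcongr; exact ht.2
  linarith

/-- Existence for a bounded feedback. The solutions for Lipschitz monotone approximations of `F`
need not be known to converge, but their images under `L` do, by `energy_sub_le_of_approx`; as the
vector field depends on `L x` only, dominated convergence in the integral equation yields the
solution. -/
lemma exists_hasDerivWithinAt_feedbackField_of_bounded {L : Matrix ι ι ℝ} (hL : L.PosSemidef)
    {F : ℝ → ℝ} (hF : Monotone F) (huc : UniformContinuous F) {M : ℝ} (hM : ∀ s, |F s| ≤ M)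
    {τ : ℝ} (hτ : 0 ≤ τ) (x₀ : ι → ℝ) :
    ∃ x : ℝ → ι → ℝ, x 0 = x₀ ∧
      ∀ t ∈ Set.Icc 0 τ, HasDerivWithinAt x (feedbackField L F (x t)) (Set.Icc 0 τ) t := by
  classical
  have hM0 : 0 ≤ M := (abs_nonneg _).trans (hM 0)
  choose G K hGm hGl hGa using fun k : ℕ =>
    exists_lipschitzWith_monotone_approx hF huc (Nat.one_div_pos_of_nat (α := ℝ) (n := k))
  have hε1 : ∀ k : ℕ, 1 / ((k : ℝ) + 1) ≤ 1 := fun k => by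
    rw [div_le_one (by positivity)]; linarith [k.cast_nonneg (α := ℝ)]
  have hGM : ∀ k s, |G k s| ≤ M + 1 := fun k s => by
    have h := abs_add_le (F s) (G k s - F s)
    rw [add_sub_cancel] at h
    linarith [hM s, hGa k s, hε1 k]
  choose K' hK' using fun k => exists_lipschitzWith_feedbackField L (hGl k)
  have hvM : ∀ k x, ‖feedbackField L (G k) x‖ ≤ M + 1 := fun k =>
    norm_feedbackField_le L (hGM k)
  choose x hx0 hxd hxi using fun k =>
    exists_eq_integral_of_lipschitzWith (hK' k) (hvM k) hτ x₀
  have hxlip : ∀ k, ∀ s ∈ Set.Icc 0 τ, ∀ t ∈ Set.Icc 0 τ,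
      ‖x k t - x k s‖ ≤ (M + 1) * ‖t - s‖ := fun k s hs t ht =>
    (convex_Icc 0 τ).norm_image_sub_le_of_norm_hasDerivWithin_le (hxd k) (fun u _ => hvM k _) hs ht
  set A := L.mulVecLin.toContinuousLinearMap with hA
  set B := ‖A‖ * (2 * ((M + 1) * τ)) with hB
  have hBnn : 0 ≤ B := by positivity
  have hxB : ∀ j k, ∀ t ∈ Set.Icc 0 τ, ∀ i, |(L *ᵥ (x j t - x k t)) i| ≤ B := by
    intro j k t ht i
    have h1 : ∀ k, ‖x k t - x₀‖ ≤ (M + 1) * τ := fun k => by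
      have := hxlip k 0 ⟨le_rfl, hτ⟩ t ht
      rw [hx0, sub_zero, Real.norm_of_nonneg ht.1] at this
      exact this.trans (by gcongr; exact ht.2)
    have h2 : ‖x j t - x k t‖ ≤ 2 * ((M + 1) * τ) := by
      have := norm_sub_le (x j t - x₀) (x k t - x₀)
      rw [sub_sub_sub_cancel_right] at this
      linarith [h1 j, h1 k]
    calc |(L *ᵥ (x j t - x k t)) i| ≤ ‖A (x j t - x k t)‖ := norm_le_pi_norm (L *ᵥ _) i
      _ ≤ ‖A‖ * ‖x j t - x k t‖ := A.le_opNorm _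
      _ ≤ B := by rw [hB]; gcongr
  have hconv : ∀ t i, ∃ a, t ∈ Set.Icc 0 τ → Tendsto (fun k => (L *ᵥ x k t) i) atTop (𝓝 a) := by
    intro t i
    by_cases ht : t ∈ Set.Icc 0 τ
    swap
    · exact ⟨0, fun h => absurd h ht⟩
    have hLnn : 0 ≤ L i i := by
      simpa [energy, single_one_dotProduct] using energy_nonneg hL (Pi.single i 1)
    suffices h : CauchySeq fun k => (L *ᵥ x k t) i by
      obtain ⟨a, ha⟩ := cauchySeq_tendsto_of_complete h
      exact ⟨a, fun _ => ha⟩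
    refine cauchySeq_of_le_tendsto_0 (fun N : ℕ => √(L i i * (2 * (Fintype.card ι *
      (B * (1 / ((N : ℝ) + 1) + 1 / ((N : ℝ) + 1)))) * τ))) ?_ ?_
    · intro j k N hj hk
      rw [Real.dist_eq, ← Pi.sub_apply, ← mulVec_sub]
      refine Real.abs_le_sqrt ((sq_mulVec_le hL _ i).trans ?_)
      have h := energy_sub_le_of_approx hL hF (hGa j) (hGa k) (hxd j) (hxd k)
        ((hx0 j).trans (hx0 k).symm) (hxB j k) t ht
      have hj' : 1 / ((j : ℝ) + 1) ≤ 1 / ((N : ℝ) + 1) := Nat.one_div_le_one_div hj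
      have hk' : 1 / ((k : ℝ) + 1) ≤ 1 / ((N : ℝ) + 1) := Nat.one_div_le_one_div hk
      refine mul_le_mul_of_nonneg_left (h.trans ?_) hLnn
      gcongr
    · have h1 := tendsto_one_div_add_atTop_nhds_zero_nat (𝕜 := ℝ)
      have h2 := (((((h1.add h1).const_mul B).const_mul (Fintype.card ι : ℝ)).const_mul
        2).mul_const τ).const_mul (L i i)
      have h3 := (Real.continuous_sqrt.tendsto _).comp h2
      simpa [Function.comp_def] using h3
  choose g hg using hconv
  have hmem : ∀ t ∈ Set.Icc 0 τ, Set.uIoc 0 t ⊆ Set.Icc 0 τ := fun t ht s hs => by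
    rw [Set.uIoc_of_le ht.1] at hs
    exact ⟨hs.1.le, hs.2.trans ht.2⟩
  have hfield : ∀ t ∈ Set.Icc 0 τ,
      Tendsto (fun k => feedbackField L (G k) (x k t)) atTop (𝓝 fun i => F (-g t i)) := by
    intro t ht
    rw [tendsto_pi_nhds]
    intro i
    have h1 : Tendsto (fun k => F (-(L *ᵥ x k t) i)) atTop (𝓝 (F (-g t i))) :=
      (huc.continuous.tendsto _).comp (hg t i ht).neg
    have h2 : Tendsto (fun k => G k (-(L *ᵥ x k t) i) - F (-(L *ᵥ x k t) i)) atTop (𝓝 0) :=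
      squeeze_zero_norm (fun k => hGa k _) tendsto_one_div_add_atTop_nhds_zero_nat
    simpa [feedbackField] using h2.add h1
  set y : ℝ → ι → ℝ := fun t => x₀ + ∫ s in (0 : ℝ)..t, fun i => F (-g s i) with hy
  have hxy : ∀ t ∈ Set.Icc 0 τ, Tendsto (fun k => x k t) atTop (𝓝 (y t)) := by
    intro t ht
    simp_rw [fun k => hxi k t ht]
    refine Tendsto.const_add _ ?_
    refine intervalIntegral.tendsto_integral_filter_of_dominated_convergence (fun _ => M + 1) ?_ ?_
      intervalIntegrable_const ?_
    · refine Eventually.of_forall fun k => ContinuousOn.aestronglyMeasurable ?_ measurableSet_uIoc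
      exact ((hK' k).continuous.comp_continuousOn
        (fun s hs => (hxd k s hs).continuousWithinAt)).mono (hmem t ht)
    · exact Eventually.of_forall fun k => Eventually.of_forall fun s _ => hvM k _
    · exact Eventually.of_forall fun s hs => hfield s (hmem t ht hs)
  have hLy : ∀ t ∈ Set.Icc 0 τ, ∀ i, (L *ᵥ y t) i = g t i := fun t ht i =>
    tendsto_nhds_unique
      (((continuous_apply i).comp (continuous_mulVec L)).continuousAt.tendsto.comp (hxy t ht))
      (hg t i ht)
  have hycont : ContinuousOn y (Set.Icc 0 τ) := by
    refine LipschitzOnWith.continuousOn (K := (M + 1).toNNReal)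
      (LipschitzOnWith.of_dist_le_mul fun t ht s hs => ?_)
    rw [dist_eq_norm, dist_eq_norm, Real.coe_toNNReal _ (by positivity)]
    exact le_of_tendsto ((hxy t ht).sub (hxy s hs)).norm
      (Eventually.of_forall fun k => hxlip k s hs t ht)
  have hyeq : ∀ t ∈ Set.Icc 0 τ, y t = ODE.picard (fun _ => feedbackField L F) 0 x₀ y t := by
    intro t ht
    rw [ODE.picard_apply, hy]
    refine congrArg (x₀ + ·) (intervalIntegral.integral_congr_ae
      (Eventually.of_forall fun s hs => ?_))
    funext i
    simp only [feedbackField, ← hLy s (hmem t ht hs) i, hy]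
  refine ⟨y, by simp [hy], fun t ht => ?_⟩
  have h := ODE.hasDerivWithinAt_picard_Icc (f := fun _ => feedbackField L F) (u := Set.univ)
    (t₀ := 0) ⟨le_rfl, hτ⟩
    (((continuous_feedbackField L huc.continuous).comp continuous_snd).continuousOn) hycont
    (fun _ _ => Set.mem_univ _) x₀ ht
  exact h.congr hyeq (hyeq t ht)

/-- As the energy decreases along solutions, `L x` stays in a bounded set. So `F` may be replaced by
a function that is constant outside a compact interval. -/
lemma exists_hasDerivWithinAt_feedbackField {L : Matrix ι ι ℝ} (hL : L.PosSemidef)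
    {F : ℝ → ℝ} (hF : Monotone F) (hFc : Continuous F) (hF0 : F 0 = 0)
    {τ : ℝ} (hτ : 0 ≤ τ) (x₀ : ι → ℝ) :
    ∃ x : ℝ → ι → ℝ, x 0 = x₀ ∧
      ∀ t ∈ Set.Icc 0 τ, HasDerivWithinAt x (feedbackField L F (x t)) (Set.Icc 0 τ) t := by
  classical
  set R := ∑ i, √(L i i * energy L x₀) with hR
  have hR0 : 0 ≤ R := Finset.sum_nonneg fun _ _ => Real.sqrt_nonneg _
  have hRi : ∀ i, √(L i i * energy L x₀) ≤ R := fun i =>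
    Finset.single_le_sum (f := fun i => √(L i i * energy L x₀))
      (fun _ _ => Real.sqrt_nonneg _) (Finset.mem_univ i)
  have hRR : -R ≤ R := by linarith
  set FR : ℝ → ℝ := Set.IccExtend hRR (fun s : Set.Icc (-R) R => F s) with hFR
  have hFRm : Monotone FR := Monotone.IccExtend hRR fun a b h => hF h
  have hFReq : ∀ s ∈ Set.Icc (-R) R, FR s = F s := fun s hs => Set.IccExtend_of_mem hRR _ hs
  have hFRuc : UniformContinuous FR :=
    (CompactSpace.uniformContinuous_of_continuous
      (hFc.comp continuous_subtype_val)).comp (LipschitzWith.projIcc hRR).uniformContinuous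
  have hFRM : ∀ s, |FR s| ≤ |F (-R)| + |F R| := by
    intro s
    have h1 : F (-R) ≤ FR s := hF (Set.projIcc (-R) R hRR s).2.1
    have h2 : FR s ≤ F R := hF (Set.projIcc (-R) R hRR s).2.2
    rw [abs_le]
    constructor
    · linarith [neg_abs_le (F (-R)), abs_nonneg (F R)]
    · linarith [le_abs_self (F R), abs_nonneg (F (-R))]
  obtain ⟨x, hx0, hx⟩ :=
    exists_hasDerivWithinAt_feedbackField_of_bounded hL hFRm hFRuc hFRM hτ x₀
  refine ⟨x, hx0, fun t ht => ?_⟩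
  have hE := fun t ht => hasDerivWithinAt_energy hL.isHermitian (hx t ht)
  have hFR0 : FR 0 = 0 := by rw [hFReq 0 ⟨by linarith, hR0⟩, hF0]
  have hanti : AntitoneOn (fun t => energy L (x t)) (Set.Icc 0 τ) := by
    refine antitoneOn_of_hasDerivWithinAt_nonpos (convex_Icc 0 τ)
      (fun t ht => (hE t ht).continuousWithinAt)
      (fun t ht => (hE t (interior_subset ht)).mono interior_subset) fun t _ => ?_
    refine mul_nonpos_of_nonneg_of_nonpos zero_le_two (Finset.sum_nonpos fun i _ => ?_)
    rcases le_total ((L *ᵥ x t) i) 0 with h | h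
    · exact mul_nonpos_of_nonpos_of_nonneg h (hFR0 ▸ hFRm (neg_nonneg.2 h))
    · exact mul_nonpos_of_nonneg_of_nonpos h (hFR0 ▸ hFRm (neg_nonpos.2 h))
  have hbound : ∀ i, |(L *ᵥ x t) i| ≤ R := fun i => by
    refine (Real.abs_le_sqrt ((sq_mulVec_le hL (x t) i).trans ?_)).trans (hRi i)
    have h0 : 0 ≤ L i i := by
      simpa [energy, single_one_dotProduct] using energy_nonneg hL (Pi.single i 1)
    have := hanti ⟨le_rfl, hτ⟩ ht ht.1
    simp only [hx0] at this
    gcongr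
  refine (hx t ht).congr_deriv ?_
  funext i
  have := abs_le.1 (hbound i)
  exact hFReq _ ⟨by linarith, by linarith⟩

/-- Global existence: by uniqueness the solutions on the intervals `[0, τ]` fit together. -/
theorem exists_hasDerivWithinAt_Ici_feedbackField {L : Matrix ι ι ℝ} (hL : L.PosSemidef)
    {F : ℝ → ℝ} (hF : Monotone F) (hFc : Continuous F) (hF0 : F 0 = 0) (x₀ : ι → ℝ) :
    ∃ x : ℝ → ι → ℝ, x 0 = x₀ ∧
      ∀ t, 0 ≤ t → HasDerivWithinAt x (feedbackField L F (x t)) (Set.Ici 0) t := by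
  have hex : ∀ τ : ℝ, ∃ x : ℝ → ι → ℝ, 0 ≤ τ → x 0 = x₀ ∧
      ∀ t ∈ Set.Icc 0 τ, HasDerivWithinAt x (feedbackField L F (x t)) (Set.Icc 0 τ) t := by
    intro τ
    by_cases hτ : 0 ≤ τ
    · obtain ⟨x, hx⟩ := exists_hasDerivWithinAt_feedbackField hL hF hFc hF0 hτ x₀
      exact ⟨x, fun _ => hx⟩
    · exact ⟨0, fun h => absurd h hτ⟩
  choose X hX using hex
  have hXX : ∀ t, 0 ≤ t → ∀ τ₁ τ₂, t ≤ τ₁ → τ₁ ≤ τ₂ → X τ₁ t = X τ₂ t := by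
    intro t ht τ₁ τ₂ h1 h2
    obtain ⟨h10, h1d⟩ := hX τ₁ (ht.trans h1)
    obtain ⟨h20, h2d⟩ := hX τ₂ (ht.trans (h1.trans h2))
    refine eqOn_of_hasDerivWithinAt_feedbackField hL hF h1d (fun s hs => ?_)
      (h10.trans h20.symm) ⟨ht, h1⟩
    exact (h2d s ⟨hs.1, hs.2.trans h2⟩).mono (Set.Icc_subset_Icc_right h2)
  refine ⟨fun t => X (t + 1) t, (hX (0 + 1) (by norm_num)).1, fun t ht => ?_⟩
  have hnear : ∀ s ∈ Set.Icc 0 (t + 1), X (s + 1) s = X (t + 2) s := fun s hs =>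
    hXX s hs.1 _ _ (by linarith) (by linarith [hs.2])
  have hd := (hX (t + 2) (by linarith)).2 t ⟨ht, by linarith⟩
  have hd' : HasDerivWithinAt (X (t + 2)) (feedbackField L F (X (t + 1) t))
      (Set.Icc 0 (t + 1)) t := by
    rw [hnear t ⟨ht, by linarith⟩]
    exact hd.mono (Set.Icc_subset_Icc_right (by linarith))
  refine (hd'.congr hnear (hnear t ⟨ht, by linarith⟩)).mono_of_mem_nhdsWithin ?_
  rw [mem_nhdsWithin]
  exact ⟨Set.Iio (t + 1), isOpen_Iio, by simp, fun s hs => ⟨hs.2, hs.1.le⟩⟩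

end Existence

/-! ### Spectral gap of a symmetric matrix -/

section Spectrum

open Matrix

variable {ι : Type*} [Fintype ι] [DecidableEq ι]

lemma sum_eigenvectorBasis_dotProduct_mul {A : Matrix ι ι ℝ} (hA : A.IsHermitian) (x y : ι → ℝ) :
    ∑ i, ((hA.eigenvectorBasis i).ofLp ⬝ᵥ x) * ((hA.eigenvectorBasis i).ofLp ⬝ᵥ y) = x ⬝ᵥ y := by
  have h := hA.eigenvectorBasis.sum_inner_mul_inner (WithLp.toLp 2 x) (WithLp.toLp 2 y)
  simp only [EuclideanSpace.inner_eq_star_dotProduct, star_trivial] at h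
  rw [dotProduct_comm x y, ← h]
  refine Finset.sum_congr rfl fun i _ => ?_
  rw [dotProduct_comm y]

/-- If each eigenvalue of `A` is `0` or at least `c`, then `c A ≤ A²` as quadratic forms. -/
lemma mul_energy_le_of_eigenvalues {A : Matrix ι ι ℝ} (hA : A.PosSemidef) {c : ℝ}
    (hc : ∀ i, hA.isHermitian.eigenvalues i = 0 ∨ c ≤ hA.isHermitian.eigenvalues i) (x : ι → ℝ) :
    c * energy A x ≤ (A *ᵥ x) ⬝ᵥ (A *ᵥ x) := by
  have hcoef : ∀ i, (hA.isHermitian.eigenvectorBasis i).ofLp ⬝ᵥ (A *ᵥ x) =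
      hA.isHermitian.eigenvalues i * ((hA.isHermitian.eigenvectorBasis i).ofLp ⬝ᵥ x) := fun i => by
    rw [dotProduct_mulVec_comm hA.isHermitian, hA.isHermitian.mulVec_eigenvectorBasis,
      dotProduct_smul, smul_eq_mul, dotProduct_comm x]
  rw [energy, ← sum_eigenvectorBasis_dotProduct_mul hA.isHermitian x (A *ᵥ x),
    ← sum_eigenvectorBasis_dotProduct_mul hA.isHermitian (A *ᵥ x) (A *ᵥ x), Finset.mul_sum]
  refine Finset.sum_le_sum fun i _ => ?_
  rw [hcoef i]
  have h0 := hA.eigenvalues_nonneg i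
  rcases hc i with h | h
  · simp [h]
  · nlinarith [mul_nonneg (mul_nonneg h0 (sub_nonneg.2 h))
      (sq_nonneg ((hA.isHermitian.eigenvectorBasis i).ofLp ⬝ᵥ x))]

lemma eigenvectorBasis_ofLp_ne_zero {A : Matrix ι ι ℝ} (hA : A.IsHermitian) (i : ι) :
    (hA.eigenvectorBasis i).ofLp ≠ 0 :=
  (WithLp.ofLp_eq_zero 2).ne.2 (hA.eigenvectorBasis.orthonormal.ne_zero i)

/-- A symmetric matrix whose kernel is at most a line has at most one zero eigenvalue. -/
lemma eq_of_eigenvalues_eq_zero {A : Matrix ι ι ℝ} (hA : A.IsHermitian) {v : ι → ℝ}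
    (hv : ∀ x, A *ᵥ x = 0 → ∃ c : ℝ, x = c • v) {i j : ι} (hi : hA.eigenvalues i = 0)
    (hj : hA.eigenvalues j = 0) : i = j := by
  by_contra hij
  have hker : ∀ k, hA.eigenvalues k = 0 → ∃ c : ℝ, (hA.eigenvectorBasis k).ofLp = c • v :=
    fun k hk => hv _ (by rw [hA.mulVec_eigenvectorBasis, hk, zero_smul])
  obtain ⟨a, ha⟩ := hker i hi
  obtain ⟨b, hb⟩ := hker j hj
  have h0 := hA.eigenvectorBasis.inner_eq_zero hij
  rw [EuclideanSpace.inner_eq_star_dotProduct, star_trivial, ha, hb, smul_dotProduct,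
    dotProduct_smul, smul_eq_mul, smul_eq_mul] at h0
  have hi0 := eigenvectorBasis_ofLp_ne_zero hA i
  have hj0 := eigenvectorBasis_ofLp_ne_zero hA j
  rw [ha] at hi0
  rw [hb] at hj0
  rw [smul_ne_zero_iff] at hi0 hj0
  have := dotProduct_self_eq_zero.ne.2 hi0.2
  simp_all

end Spectrum

/-! ### Minors of the Laplacian -/

section MinorDeterminant

open Matrix

/-- A weakly diagonally dominant matrix with nonnegative diagonal has no negative determinant: on
the segment from the identity to it, the matrices are strictly diagonally dominant, hence regular.
-/
lemma Matrix.det_pos_of_sum_row_le_diag {ι : Type*} [Fintype ι] [DecidableEq ι]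
    {M : Matrix ι ι ℝ} (h : ∀ j, ∑ k ∈ Finset.univ.erase j, |M j k| ≤ M j j) (hM : M.det ≠ 0) :
    0 < M.det := by
  set f : ℝ → ℝ := fun t => (t • M + (1 - t) • (1 : Matrix ι ι ℝ)).det with hf
  have hcont : Continuous f := by
    refine Continuous.matrix_det ?_
    fun_prop
  by_contra hneg
  have h1 : f 1 ≤ 0 := by simpa [hf] using hneg
  have h0 : 0 ≤ f 0 := by simp [hf]
  obtain ⟨t, ht, hft⟩ := intermediate_value_Icc' zero_le_one hcont.continuousOn ⟨h1, h0⟩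
  rcases ht.2.eq_or_lt with rfl | ht1
  · exact hM (by simpa [hf] using hft)
  refine det_ne_zero_of_sum_row_lt_diag (fun j => ?_) hft
  have hoff : ∀ k ∈ Finset.univ.erase j,
      ‖(t • M + (1 - t) • (1 : Matrix ι ι ℝ)) j k‖ = t * |M j k| := fun k hk => by
    simp [one_apply_ne (Finset.ne_of_mem_erase hk).symm, abs_of_nonneg ht.1]
  rw [Finset.sum_congr rfl hoff, ← Finset.mul_sum]
  have hd : (t • M + (1 - t) • (1 : Matrix ι ι ℝ)) j j = t * M j j + (1 - t) := by simp
  rw [hd]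
  refine lt_of_lt_of_le ?_ (le_abs_self _)
  have := mul_le_mul_of_nonneg_left (h j) ht.1
  linarith

end MinorDeterminant

namespace SignedDigraph

open Matrix

variable {n : ℕ}

lemma laplacian_mulVec (G : SignedDigraph n) (x : Fin n → ℝ) (i : Fin n) :
    (G.laplacian *ᵥ x) i = ∑ j, (|G.A i j| * x i - G.A i j * x j) := by
  rw [laplacian, sub_mulVec, Pi.sub_apply, mulVec_diagonal, inDegree, Finset.sum_mul,
    Finset.sum_sub_distrib]
  rfl

/-- A vector that the reduced Laplacian of a strongly connected digraph maps to `0` vanishes: by the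
maximum principle the set where its modulus is maximal is closed under passing to in-neighbors, so
it contains the removed node, where the vector is extended by `0`. -/
lemma minorDet_ne_zero {G : SignedDigraph n} (hG : G.StronglyConnected) (i : Fin n) :
    G.minorDet i ≠ 0 := by
  intro hdet
  obtain ⟨v, hv0, hv⟩ := exists_mulVec_eq_zero_iff.2 hdet
  set z : Fin n → ℝ := fun k => if h : k ≠ i then v ⟨k, h⟩ else 0 with hz
  have hzi : z i = 0 := by simp [hz]
  have hzv : ∀ k : {j // j ≠ i}, z k = v k := fun k => by simp [hz, k.2]
  have hLz : ∀ j, j ≠ i → ∑ k, (|G.A j k| * z j - |G.A j k| * z k) = 0 := by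
    intro j hj
    have h1 := congrFun hv ⟨j, hj⟩
    have h2 := laplacian_mulVec G.inducedUnsigned z j
    simp only [inducedUnsigned, of_apply, abs_abs] at h2
    rw [← h2, mulVec, dotProduct, ← Fintype.sum_subtype_add_sum_subtype (fun k => k ≠ i)]
    rw [Finset.sum_eq_zero (s := (Finset.univ : Finset {k // ¬ k ≠ i})), add_zero]
    · simpa [mulVec, dotProduct, hzv, inducedUnsigned] using h1
    · intro k _
      rw [not_not.1 k.2, hzi, mul_zero]
  have : Nonempty (Fin n) := ⟨i⟩
  obtain ⟨j₀, hj₀⟩ := Finite.exists_max fun k => |z k|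
  have hstep : ∀ j k, j ≠ i → |z j| = |z j₀| → G.Edge k j → |z k| = |z j₀| := by
    intro j k hj hjm hkj
    have h1 : ∑ k, |G.A j k| * (|z j₀| - |z k|) ≤ 0 := by
      have h2 : (∑ k, |G.A j k|) * z j = ∑ k, |G.A j k| * z k := by
        have := hLz j hj
        rw [Finset.sum_sub_distrib, sub_eq_zero] at this
        rw [Finset.sum_mul, this]
      have h3 : (∑ k, |G.A j k|) * |z j₀| ≤ ∑ k, |G.A j k| * |z k| := by
        rw [← hjm, ← abs_of_nonneg (Finset.sum_nonneg fun k _ => abs_nonneg (G.A j k)), ← abs_mul,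
          h2]
        refine (Finset.abs_sum_le_sum_abs _ _).trans (Finset.sum_le_sum fun k _ => ?_)
        rw [abs_mul, abs_abs]
      simp only [mul_sub, Finset.sum_sub_distrib]
      rw [Finset.sum_mul] at h3
      linarith
    have h4 : ∀ k ∈ Finset.univ, 0 ≤ |G.A j k| * (|z j₀| - |z k|) := fun k _ =>
      mul_nonneg (abs_nonneg _) (sub_nonneg.2 (hj₀ k))
    have h5 := (Finset.sum_eq_zero_iff_of_nonneg h4).1 (le_antisymm h1 (Finset.sum_nonneg h4)) k
      (Finset.mem_univ k)
    rcases mul_eq_zero.1 h5 with h | h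
    · exact absurd (abs_eq_zero.1 h) hkj
    · linarith
  have hmax : |z i| = |z j₀| := by
    by_cases hij : i = j₀
    · rw [hij]
    have key : ∀ a, Relation.TransGen G.Edge a j₀ → |z a| = |z j₀| ∨ |z i| = |z j₀| := by
      intro a ha
      induction ha using Relation.TransGen.head_induction_on with
      | single h => exact Or.inl (hstep _ _ (Ne.symm hij) rfl h)
      | @head b c h _ ih =>
        by_cases hc : c = i
        · right
          rcases ih with h | h
          · rwa [hc] at h
          · exact h
        · exact ih.imp_left fun h' => hstep _ _ hc h' h
    exact (key i (hG i j₀ hij)).elim id id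
  refine hv0 (funext fun k => ?_)
  have := hj₀ k
  simp only [← hmax, hzi, abs_zero, hzv] at this
  exact abs_nonpos_iff.1 this

lemma minorDet_pos {G : SignedDigraph n} (hG : G.StronglyConnected) (i : Fin n) :
    0 < G.minorDet i := by
  refine det_pos_of_sum_row_le_diag (fun j => ?_) (minorDet_ne_zero hG i)
  have hoff : ∀ k ∈ Finset.univ.erase j, |G.inducedUnsigned.laplacian.submatrix
      (Subtype.val : {j : Fin n // j ≠ i} → Fin n) Subtype.val j k| = |G.A j k| := by
    intro k hk
    have : (j : Fin n) ≠ k := fun h => Finset.ne_of_mem_erase hk (Subtype.ext h.symm)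
    simp [laplacian, inducedUnsigned, diagonal_apply_ne _ this]
  rw [Finset.sum_congr rfl hoff]
  have hd : G.inducedUnsigned.laplacian.submatrix
      (Subtype.val : {j : Fin n // j ≠ i} → Fin n) Subtype.val j j = ∑ k, |G.A j k| := by
    simp [laplacian, inducedUnsigned, inDegree, G.no_loops]
  rw [hd, ← Fintype.sum_subtype_add_sum_subtype (fun k => k ≠ i) fun k => |G.A j k|]
  refine le_add_of_le_of_nonneg ?_ (Finset.sum_nonneg fun _ _ => abs_nonneg _)
  exact Finset.sum_le_sum_of_subset_of_nonneg (Finset.erase_subset _ _) fun _ _ _ => abs_nonneg _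

end SignedDigraph

namespace SignedDigraph

open Matrix

variable {n : ℕ}

/-! ### Structural balance -/

/-- A structural balance is the same as signs `σ i = ±1` with `σ i * σ j * a_ij ≥ 0`. -/
lemma structurallyBalanced_iff {G : SignedDigraph n} : G.StructurallyBalanced ↔
    ∃ σ : Fin n → ℝ, (∀ i, σ i = 1 ∨ σ i = -1) ∧ ∀ i j, 0 ≤ σ i * σ j * G.A i j := by
  classical
  constructor
  · rintro ⟨V₁, V₂, hun, -, h11, h22, h12, h21⟩
    refine ⟨fun i => if i ∈ V₁ then 1 else -1, fun i => by dsimp only; split_ifs <;> simp,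
      fun i j => ?_⟩
    have hmem : ∀ k, k ∉ V₁ → k ∈ V₂ := fun k hk =>
      (hun.symm ▸ Set.mem_univ k : k ∈ V₁ ∪ V₂).resolve_left hk
    dsimp only
    split_ifs with hi hj hj
    · simpa using h11 i hi j hj
    · simpa using h12 i hi j (hmem j hj)
    · simpa using h21 i (hmem i hi) j hj
    · simpa using h22 i (hmem i hi) j (hmem j hj)
  · rintro ⟨σ, hσ, h⟩
    have hneg : ∀ k, ¬ σ k = 1 → σ k = -1 := fun k => (hσ k).resolve_left
    refine ⟨{i | σ i = 1}, {i | ¬ σ i = 1}, Set.union_compl_self _, disjoint_compl_right,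
      ?_, ?_, ?_, ?_⟩ <;> intro i hi j hj <;> have h' := h i j
    · rw [show σ i = 1 from hi, show σ j = 1 from hj] at h'; linarith
    · rw [hneg i hi, hneg j hj] at h'; linarith
    · rw [show σ i = 1 from hi, hneg j hj] at h'; linarith
    · rw [hneg i hi, show σ j = 1 from hj] at h'; linarith

/-! ### The mirror graph -/

lemma mirror_A (G : SignedDigraph n) (i j : Fin n) :
    G.mirror.A i j = (G.minorDet i * G.A i j + G.minorDet j * G.A j i) / 2 := rfl

lemma mirror_A_comm (G : SignedDigraph n) (i j : Fin n) : G.mirror.A i j = G.mirror.A j i := by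
  rw [mirror_A, mirror_A, add_comm]

/-- As `a_ij` and `a_ji` do not have opposite signs, they do not cancel in the mirror graph. -/
lemma mul_mirror_A_pos {G : SignedDigraph n} (hG : G.StronglyConnected) {i j : Fin n}
    (h : G.A i j ≠ 0) : 0 < G.A i j * G.mirror.A i j := by
  have h1 : 0 < G.minorDet i * (G.A i j) ^ 2 := mul_pos (minorDet_pos hG i) (by positivity)
  have h2 := mul_nonneg (minorDet_pos hG j).le (G.digon_sign_symmetric i j)
  rw [mirror_A]
  linarith

lemma balanced_mirror {G : SignedDigraph n} (hG : G.StronglyConnected) {σ : Fin n → ℝ}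
    (h : ∀ i j, 0 ≤ σ i * σ j * G.A i j) (i j : Fin n) : 0 ≤ σ i * σ j * G.mirror.A i j := by
  have h1 := mul_nonneg (minorDet_pos hG i).le (h i j)
  have h2 := mul_nonneg (minorDet_pos hG j).le (h j i)
  rw [mirror_A]
  linarith

lemma abs_mul_sign (a : ℝ) : |a| * Real.sign a = a := by
  rcases lt_trichotomy a 0 with h | rfl | h
  · rw [Real.sign_of_neg h, abs_of_neg h]; ring
  · simp
  · rw [Real.sign_of_pos h, abs_of_pos h, mul_one]

lemma abs_mul_sub_sign_mul (a x y : ℝ) : |a| * (x - Real.sign a * y) = |a| * x - a * y := by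
  rw [mul_sub, ← mul_assoc, abs_mul_sign]

lemma mirrorFeedback_eq (G : SignedDigraph n) (x : Fin n → ℝ) (i : Fin n) :
    G.mirrorFeedback x i = -(G.mirror.laplacian *ᵥ x) i := by
  classical
  rw [mirrorFeedback, laplacian_mulVec, neighbors, Finset.sum_filter_of_ne]
  · simp_rw [abs_mul_sub_sign_mul]
  · rintro j - h h0
    exact h (by simp [h0])

lemma energy_mirror_laplacian (G : SignedDigraph n) (x : Fin n → ℝ) :
    energy G.mirror.laplacian x =
      (∑ i, ∑ j, |G.mirror.A i j| * (x i - Real.sign (G.mirror.A i j) * x j) ^ 2) / 2 := by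
  have hterm : ∀ i j, |G.mirror.A i j| * (x i - Real.sign (G.mirror.A i j) * x j) ^ 2 =
      x i * (|G.mirror.A i j| * x i - G.mirror.A i j * x j) +
        x j * (|G.mirror.A j i| * x j - G.mirror.A j i * x i) := by
    intro i j
    rw [← mirror_A_comm G i j]
    generalize G.mirror.A i j = a
    have h1 := abs_mul_sign a
    have h2 : |a| * Real.sign a ^ 2 = |a| := by
      rcases eq_or_ne a 0 with rfl | h
      · simp
      · rcases Real.sign_apply_eq_of_ne_zero a h with h | h <;> rw [h] <;> ring
    calc _ = |a| * x i ^ 2 - 2 * (|a| * Real.sign a) * x i * x j +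
          |a| * Real.sign a ^ 2 * x j ^ 2 := by ring
      _ = _ := by rw [h1, h2]; ring
  simp_rw [hterm, Finset.sum_add_distrib]
  rw [Finset.sum_comm (f := fun i j => x j * (|G.mirror.A j i| * x j - G.mirror.A j i * x i)),
    add_self_div_two, energy, dotProduct]
  simp_rw [laplacian_mulVec, Finset.mul_sum]

lemma posSemidef_mirror_laplacian (G : SignedDigraph n) : G.mirror.laplacian.PosSemidef :=
  PosSemidef.of_dotProduct_mulVec_nonneg G.mirror_laplacian_isHermitian fun x => by
    have h := energy_mirror_laplacian G x
    rw [star_trivial]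
    change 0 ≤ energy _ _
    rw [h]
    positivity

/-- In the kernel of the mirror Laplacian neighboring coordinates agree up to the sign of the
edge. -/
lemma eq_sign_mul_of_mirror_laplacian_mulVec_eq_zero {G : SignedDigraph n} {x : Fin n → ℝ}
    (hx : G.mirror.laplacian *ᵥ x = 0) {i j : Fin n} (h : G.mirror.A i j ≠ 0) :
    x i = Real.sign (G.mirror.A i j) * x j := by
  have h0 : energy G.mirror.laplacian x = 0 := by rw [energy, hx, dotProduct_zero]
  rw [energy_mirror_laplacian, div_eq_zero_iff, or_iff_left two_ne_zero] at h0
  have hnn : ∀ i j, 0 ≤ |G.mirror.A i j| * (x i - Real.sign (G.mirror.A i j) * x j) ^ 2 :=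
    fun i j => by positivity
  have h1 := (Finset.sum_eq_zero_iff_of_nonneg fun i _ => Finset.sum_nonneg fun j _ => hnn i j).1
    h0 i (Finset.mem_univ i)
  have h2 := (Finset.sum_eq_zero_iff_of_nonneg fun j _ => hnn i j).1 h1 j (Finset.mem_univ j)
  have h3 := (mul_eq_zero.1 h2).resolve_left (abs_ne_zero.2 h)
  exact sub_eq_zero.1 (pow_eq_zero_iff two_ne_zero |>.1 h3)

/-- A function that is invariant along the edges of a strongly connected digraph is constant. -/
lemma StronglyConnected.eq_of_edge {G : SignedDigraph n} (hG : G.StronglyConnected) {α : Type*}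
    {f : Fin n → α} (hf : ∀ i j, G.A i j ≠ 0 → f i = f j) (i j : Fin n) : f i = f j := by
  rcases eq_or_ne i j with rfl | h
  · rfl
  have key : ∀ b, Relation.TransGen G.Edge i b → f i = f b := by
    intro b hb
    induction hb with
    | single h => exact (hf _ _ h).symm
    | tail _ h ih => exact ih.trans (hf _ _ h).symm
  exact key j (hG i j h)

lemma mirror_A_ne_zero {G : SignedDigraph n} (hG : G.StronglyConnected) {i j : Fin n}
    (h : G.A i j ≠ 0) : G.mirror.A i j ≠ 0 :=
  right_ne_zero_of_mul (mul_mirror_A_pos hG h).ne'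

/-- The mirror Laplacian of a structurally unbalanced graph is regular: the signs of a nonzero
vector in the kernel would be a structural balance. -/
lemma eq_zero_of_mirror_laplacian_mulVec_eq_zero {G : SignedDigraph n} (hG : G.StronglyConnected)
    (hub : G.StructurallyUnbalanced) {x : Fin n → ℝ} (hx : G.mirror.laplacian *ᵥ x = 0) :
    x = 0 := by
  have habs : ∀ i j, |x i| = |x j| := hG.eq_of_edge fun i j h => by
    have h' := mirror_A_ne_zero hG h
    rw [eq_sign_mul_of_mirror_laplacian_mulVec_eq_zero hx h', abs_mul]
    rcases Real.sign_apply_eq_of_ne_zero _ h' with h | h <;> rw [h] <;> simp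
  by_contra hne
  obtain ⟨k, hk⟩ := Function.ne_iff.1 hne
  have hx0 : ∀ i, x i ≠ 0 := fun i h => hk (by
    have := habs k i
    rw [h, abs_zero] at this
    exact abs_eq_zero.1 this)
  refine hub (structurallyBalanced_iff.2 ⟨fun i => Real.sign (x i),
    fun i => (Real.sign_apply_eq_of_ne_zero _ (hx0 i)).symm, fun i j => ?_⟩)
  rcases eq_or_ne (G.A i j) 0 with h | h
  · simp [h]
  have h1 : 0 < G.A i j * Real.sign (G.mirror.A i j) := by
    have h2 := mul_mirror_A_pos hG h
    rw [← abs_mul_sign (G.mirror.A i j), mul_left_comm] at h2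
    exact pos_of_mul_pos_right h2 (abs_nonneg _)
  have h3 : 0 < x i * x j * G.A i j := by
    rw [eq_sign_mul_of_mirror_laplacian_mulVec_eq_zero hx (mirror_A_ne_zero hG h)]
    have := mul_pos h1 (pow_pos (abs_pos.2 (hx0 j)) 2)
    rw [sq_abs] at this
    linarith
  rw [← abs_mul_sign (x i), ← abs_mul_sign (x j)] at h3
  have h4 : 0 < |x i| * |x j| * (Real.sign (x i) * Real.sign (x j) * G.A i j) := by linarith
  exact (pos_of_mul_pos_right h4 (by positivity)).le

lemma mirror_laplacian_mulVec_sign {G : SignedDigraph n} (hG : G.StronglyConnected)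
    {σ : Fin n → ℝ} (hσ : ∀ i, σ i = 1 ∨ σ i = -1) (h : ∀ i j, 0 ≤ σ i * σ j * G.A i j) :
    G.mirror.laplacian *ᵥ σ = 0 := by
  funext i
  rw [laplacian_mulVec]
  refine Finset.sum_eq_zero fun j _ => ?_
  have h1 := balanced_mirror hG h i j
  generalize G.mirror.A i j = a at h1
  rcases hσ i with hi | hi <;> rcases hσ j with hj | hj <;> rw [hi, hj] at h1 ⊢
  · rw [abs_of_nonneg (by linarith)]; ring
  · rw [abs_of_nonpos (by linarith)]; ring
  · rw [abs_of_nonpos (by linarith)]; ring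
  · rw [abs_of_nonneg (by linarith)]; ring

lemma eq_smul_of_mirror_laplacian_mulVec_eq_zero {G : SignedDigraph n} (hG : G.StronglyConnected)
    {σ : Fin n → ℝ} (hσ : ∀ i, σ i = 1 ∨ σ i = -1) (h : ∀ i j, 0 ≤ σ i * σ j * G.A i j)
    {x : Fin n → ℝ} (hx : G.mirror.laplacian *ᵥ x = 0) (k : Fin n) : x = (σ k * x k) • σ := by
  have hconst : ∀ i j, σ i * x i = σ j * x j := hG.eq_of_edge fun i j hij => by
    have h' := mirror_A_ne_zero hG hij
    have h1 := balanced_mirror hG h i j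
    rw [eq_sign_mul_of_mirror_laplacian_mulVec_eq_zero hx h']
    generalize G.mirror.A i j = a at h1 h'
    rcases h'.lt_or_gt with ha | ha
    · rw [Real.sign_of_neg ha]
      rcases hσ i with hi | hi <;> rcases hσ j with hj | hj <;> rw [hi, hj] at h1 ⊢ <;> linarith
    · rw [Real.sign_of_pos ha]
      rcases hσ i with hi | hi <;> rcases hσ j with hj | hj <;> rw [hi, hj] at h1 ⊢ <;> linarith
  funext i
  rw [Pi.smul_apply, smul_eq_mul, ← hconst i k]
  rcases hσ i with hi | hi <;> rw [hi] <;> ring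

/-! ### The eigenvalues of the mirror Laplacian -/

/-- `mirrorEigenvalue` lists the family `eigenvalues` in another order. -/
noncomputable def eigenvalueEquiv (n : ℕ) : Fin n ≃ Fin n :=
  (Fin.revPerm.trans (finCongr (Fintype.card_fin n).symm)).trans
    (Fintype.equivOfCardEq (Fintype.card_fin _))

lemma eigenvalues_eigenvalueEquiv (G : SignedDigraph n) (k : Fin n) :
    G.mirror_laplacian_isHermitian.eigenvalues (eigenvalueEquiv n k) = G.mirrorEigenvalue k := by
  simp [IsHermitian.eigenvalues, mirrorEigenvalue, eigenvalueEquiv]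

lemma monotone_mirrorEigenvalue (G : SignedDigraph n) : Monotone G.mirrorEigenvalue :=
  fun _ _ h => G.mirror_laplacian_isHermitian.eigenvalues₀_antitone (Fin.rev_le_rev.2 h)

lemma mirrorEigenvalue_nonneg (G : SignedDigraph n) (k : Fin n) : 0 ≤ G.mirrorEigenvalue k := by
  rw [← eigenvalues_eigenvalueEquiv]
  exact G.posSemidef_mirror_laplacian.eigenvalues_nonneg _

lemma mirrorEigenvalue_zero_pos_of_unbalanced {G : SignedDigraph n} (hG : G.StronglyConnected)
    (hub : G.StructurallyUnbalanced) (hn : 0 < n) : 0 < G.mirrorEigenvalue ⟨0, hn⟩ := by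
  refine (mirrorEigenvalue_nonneg G _).lt_of_ne' fun h0 => ?_
  rw [← eigenvalues_eigenvalueEquiv] at h0
  refine eigenvectorBasis_ofLp_ne_zero G.mirror_laplacian_isHermitian
    (eigenvalueEquiv n ⟨0, hn⟩)
    (eq_zero_of_mirror_laplacian_mulVec_eq_zero hG hub ?_)
  rw [IsHermitian.mulVec_eigenvectorBasis, h0, zero_smul]

lemma mirrorEigenvalue_zero_mul_energy_le (G : SignedDigraph n) (hn : 0 < n) (x : Fin n → ℝ) :
    G.mirrorEigenvalue ⟨0, hn⟩ * energy G.mirror.laplacian x ≤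
      (G.mirror.laplacian *ᵥ x) ⬝ᵥ (G.mirror.laplacian *ᵥ x) := by
  refine mul_energy_le_of_eigenvalues G.posSemidef_mirror_laplacian (fun i => Or.inr ?_) x
  obtain ⟨k, rfl⟩ := (eigenvalueEquiv n).surjective i
  rw [eigenvalues_eigenvalueEquiv]
  exact monotone_mirrorEigenvalue G (Nat.zero_le _)

lemma mirrorEigenvalue_one_pos_of_balanced {G : SignedDigraph n} (hG : G.StronglyConnected)
    (hb : G.StructurallyBalanced) (hn : 1 < n) : 0 < G.mirrorEigenvalue ⟨1, hn⟩ := by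
  obtain ⟨σ, hσ, hσA⟩ := structurallyBalanced_iff.1 hb
  refine (mirrorEigenvalue_nonneg G _).lt_of_ne' fun h1 => ?_
  have h0 : G.mirrorEigenvalue ⟨0, by omega⟩ = 0 :=
    le_antisymm (h1 ▸ monotone_mirrorEigenvalue G (Nat.zero_le 1)) (mirrorEigenvalue_nonneg G _)
  rw [← eigenvalues_eigenvalueEquiv] at h0 h1
  have := eq_of_eigenvalues_eq_zero G.mirror_laplacian_isHermitian (v := σ)
    (fun x hx => ⟨_, eq_smul_of_mirror_laplacian_mulVec_eq_zero hG hσ hσA hx ⟨0, by omega⟩⟩) h0 h1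
  simp at this

lemma mirrorEigenvalue_zero_eq_zero_of_balanced {G : SignedDigraph n} (hG : G.StronglyConnected)
    (hb : G.StructurallyBalanced) (hn : 0 < n) : G.mirrorEigenvalue ⟨0, hn⟩ = 0 := by
  obtain ⟨σ, hσ, hσA⟩ := structurallyBalanced_iff.1 hb
  have hdet : G.mirror.laplacian.det = 0 := by
    refine exists_mulVec_eq_zero_iff.1 ⟨σ, fun h => ?_, mirror_laplacian_mulVec_sign hG hσ hσA⟩
    have := congrFun h ⟨0, hn⟩
    rcases hσ ⟨0, hn⟩ with h | h <;> simp [h] at this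
  rw [G.mirror_laplacian_isHermitian.det_eq_prod_eigenvalues, Finset.prod_eq_zero_iff] at hdet
  obtain ⟨i, -, hi⟩ := hdet
  obtain ⟨k, rfl⟩ := (eigenvalueEquiv n).surjective i
  rw [eigenvalues_eigenvalueEquiv] at hi
  have hk : G.mirrorEigenvalue k = 0 := hi
  exact le_antisymm (hk ▸ monotone_mirrorEigenvalue G (Nat.zero_le _)) (mirrorEigenvalue_nonneg G _)

lemma mirrorEigenvalue_one_mul_energy_le {G : SignedDigraph n} (hG : G.StronglyConnected)
    (hb : G.StructurallyBalanced) (hn : 1 < n) (x : Fin n → ℝ) :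
    G.mirrorEigenvalue ⟨1, hn⟩ * energy G.mirror.laplacian x ≤
      (G.mirror.laplacian *ᵥ x) ⬝ᵥ (G.mirror.laplacian *ᵥ x) := by
  refine mul_energy_le_of_eigenvalues G.posSemidef_mirror_laplacian (fun i => ?_) x
  obtain ⟨k, rfl⟩ := (eigenvalueEquiv n).surjective i
  rw [eigenvalues_eigenvalueEquiv]
  rcases Nat.eq_zero_or_pos k.1 with h | h
  · left
    rw [← mirrorEigenvalue_zero_eq_zero_of_balanced hG hb (by omega : 0 < n)]
    exact congrArg _ (Fin.ext h)
  · exact Or.inr (monotone_mirrorEigenvalue G h)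

end SignedDigraph

/-! ### Settling in a fixed time -/

section Settling

open Matrix

variable {ι : Type*} [Fintype ι]

/-- The sum of two odd powers, the feedback of the protocol in one coordinate. -/
noncomputable def oddPowSum (k₁ k₂ : ℝ) (m r p q : ℕ) (y : ℝ) : ℝ :=
  k₁ * oddPow y m r + k₂ * oddPow y p q

/-- The bound on the settling time for `N` nodes, where `c` is the spectral gap. -/
noncomputable def settlingBound (c N k₁ k₂ : ℝ) (m r p q : ℕ) : ℝ :=
  1 / c * (N ^ (((m : ℝ) - r) / (2 * r)) / k₁ * ((r : ℝ) / ((m : ℝ) - r)) +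
    1 / k₂ * ((q : ℝ) / ((q : ℝ) - p)))

variable {k₁ k₂ : ℝ} {m r p q : ℕ}

lemma oddPowSum_zero : oddPowSum k₁ k₂ m r p q 0 = 0 := by simp [oddPowSum, oddPow_zero]

lemma monotone_oddPowSum (hk₁ : 0 < k₁) (hk₂ : 0 < k₂) (hm : 0 < m) (hr : 0 < r) (hp : 0 < p)
    (hq : 0 < q) : Monotone (oddPowSum k₁ k₂ m r p q) :=
  ((monotone_oddPow hm hr).const_mul hk₁.le).add ((monotone_oddPow hp hq).const_mul hk₂.le)

lemma continuous_oddPowSum (hm : 0 < m) (hr : 0 < r) (hp : 0 < p) (hq : 0 < q) :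
    Continuous (oddPowSum k₁ k₂ m r p q) :=
  ((continuous_oddPow hm hr).const_mul k₁).add ((continuous_oddPow hp hq).const_mul k₂)

lemma settlingBound_nonneg {c N : ℝ} (hc : 0 < c) (hN : 0 ≤ N) (hk₁ : 0 < k₁) (hk₂ : 0 < k₂)
    (hrm : r < m) (hpq : p < q) : 0 ≤ settlingBound c N k₁ k₂ m r p q := by
  have h1 : (0 : ℝ) < (m : ℝ) - r := sub_pos.2 (Nat.cast_lt.2 hrm)
  have h2 : (0 : ℝ) < (q : ℝ) - p := sub_pos.2 (Nat.cast_lt.2 hpq)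
  unfold settlingBound
  positivity

/-- If `L² ≥ c L`, then `W = c xᵀ L x ≤ |L x|²` satisfies the differential inequality of
`eq_zero_of_deriv_le_neg_rpow_add_rpow` along solutions. The power mean inequality for the exponent
`(m + r) / (2 r) > 1` costs the power of the number of nodes. -/
theorem mulVec_eq_zero_of_settlingBound_le [Nonempty ι] {L : Matrix ι ι ℝ} (hL : L.PosSemidef)
    {c : ℝ} (hc : 0 < c) (hgap : ∀ x, c * energy L x ≤ (L *ᵥ x) ⬝ᵥ (L *ᵥ x))
    (hk₁ : 0 < k₁) (hk₂ : 0 < k₂) (hr : 0 < r) (hp : 0 < p) (hrm : r < m) (hpq : p < q)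
    {x : ℝ → ι → ℝ} (hx : ∀ t, 0 ≤ t →
      HasDerivWithinAt x (feedbackField L (oddPowSum k₁ k₂ m r p q) (x t)) (Set.Ici 0) t)
    {t : ℝ} (ht : settlingBound c (Fintype.card ι) k₁ k₂ m r p q ≤ t) : L *ᵥ x t = 0 := by
  classical
  have hm : 0 < m := hr.trans hrm
  have hq : 0 < q := hp.trans hpq
  have hmr : (0 : ℝ) < (m : ℝ) - r := sub_pos.2 (Nat.cast_lt.2 hrm)
  have hqp : (0 : ℝ) < (q : ℝ) - p := sub_pos.2 (Nat.cast_lt.2 hpq)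
  have hr' : (0 : ℝ) < r := Nat.cast_pos.2 hr
  have hq' : (0 : ℝ) < q := Nat.cast_pos.2 hq
  have hp' : (0 : ℝ) < p := Nat.cast_pos.2 hp
  set N : ℝ := ((Fintype.card ι : ℕ) : ℝ) with hN
  have hN0 : 0 < N := Nat.cast_pos.2 Fintype.card_pos
  set s₁ : ℝ := ((m : ℝ) + r) / (2 * r) with hs₁
  set s₂ : ℝ := ((p : ℝ) + q) / (2 * q) with hs₂
  have hs₁' : s₁ - 1 = ((m : ℝ) - r) / (2 * r) := by rw [hs₁]; field_simp; ring
  have hs₂' : 1 - s₂ = ((q : ℝ) - p) / (2 * q) := by rw [hs₂]; field_simp; ring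
  have hs₁1 : 1 < s₁ := by
    have : 0 < s₁ - 1 := by rw [hs₁']; positivity
    linarith
  have hs₂1 : s₂ < 1 := by
    have : 0 < 1 - s₂ := by rw [hs₂']; positivity
    linarith
  have hs₂0 : 0 < s₂ := by positivity
  set K := N ^ (s₁ - 1) with hK
  have hK0 : 0 < K := Real.rpow_pos_of_pos hN0 _
  set F := oddPowSum k₁ k₂ m r p q with hF
  have hW : ∀ t, 0 ≤ t → HasDerivWithinAt (fun t => c * energy L (x t))
      (c * (2 * ((L *ᵥ x t) ⬝ᵥ feedbackField L F (x t)))) (Set.Ici 0) t := fun t ht =>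
    (hasDerivWithinAt_energy hL.isHermitian (hx t ht)).const_mul c
  have hWnn : ∀ t, 0 ≤ t → 0 ≤ c * energy L (x t) := fun t _ =>
    mul_nonneg hc.le (energy_nonneg hL _)
  have hle : ∀ t, 0 ≤ t → c * (2 * ((L *ᵥ x t) ⬝ᵥ feedbackField L F (x t))) ≤
      -(2 * c * k₁ / K * (c * energy L (x t)) ^ s₁ + 2 * c * k₂ * (c * energy L (x t)) ^ s₂) := by
    intro t ht
    set W := c * energy L (x t)
    set g : ι → ℝ := L *ᵥ x t with hg
    have hWg : W ≤ ∑ i, g i ^ 2 := by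
      refine (hgap (x t)).trans (le_of_eq ?_)
      exact Finset.sum_congr rfl fun i _ => (sq (g i)).symm
    have hterm : ∀ i, g i * feedbackField L F (x t) i =
        -(k₁ * (g i ^ 2) ^ s₁ + k₂ * (g i ^ 2) ^ s₂) := by
      intro i
      have h1 := mul_oddPow hm hr (-g i)
      have h2 := mul_oddPow hp hq (-g i)
      rw [neg_sq] at h1 h2
      rw [hs₁, hs₂, ← h1, ← h2, feedbackField, ← hg, hF, oddPowSum]
      ring
    have hdot : g ⬝ᵥ feedbackField L F (x t) =
        -(k₁ * ∑ i, (g i ^ 2) ^ s₁ + k₂ * ∑ i, (g i ^ 2) ^ s₂) := by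
      rw [dotProduct, Finset.sum_congr rfl fun i _ => hterm i, Finset.sum_neg_distrib,
        Finset.sum_add_distrib, Finset.mul_sum, Finset.mul_sum]
    have hsum1 : W ^ s₁ / K ≤ ∑ i, (g i ^ 2) ^ s₁ := by
      rw [div_le_iff₀ hK0, mul_comm]
      refine (Real.rpow_le_rpow (hWnn t ht) hWg (by linarith)).trans ?_
      exact Real.rpow_sum_le_const_mul_sum_rpow_of_nonneg Finset.univ hs₁1.le
        fun i _ => sq_nonneg (g i)
    have hsum2 : W ^ s₂ ≤ ∑ i, (g i ^ 2) ^ s₂ :=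
      (Real.rpow_le_rpow (hWnn t ht) hWg hs₂0.le).trans
        (Real.rpow_sum_le_sum_rpow _ (fun i => sq_nonneg (g i)) hs₂0 hs₂1.le)
    rw [hdot]
    have h1 := mul_le_mul_of_nonneg_left hsum1 (by positivity : 0 ≤ 2 * c * k₁)
    have h2 := mul_le_mul_of_nonneg_left hsum2 (by positivity : 0 ≤ 2 * c * k₂)
    have h3 : 2 * c * k₁ / K * W ^ s₁ = 2 * c * k₁ * (W ^ s₁ / K) := by ring
    rw [h3]
    linarith
  have hbound : 1 / (2 * c * k₁ / K * (s₁ - 1)) + 1 / (2 * c * k₂ * (1 - s₂)) ≤ t := by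
    refine le_trans (le_of_eq ?_) ht
    rw [settlingBound, ← hs₁', ← hK, hs₁', hs₂']
    field_simp
  have h0 := eq_zero_of_deriv_le_neg_rpow_add_rpow (by positivity) (by positivity) hs₁1 hs₂1
    hW hWnn hle hbound
  have hE : energy L (x t) = 0 := (mul_eq_zero.1 h0).resolve_left hc.ne'
  funext i
  have h1 := sq_mulVec_le hL (x t) i
  rw [hE, mul_zero] at h1
  exact pow_eq_zero_iff two_ne_zero |>.1 (le_antisymm h1 (sq_nonneg _))

lemma eq_of_mulVec_eq_zero {L : Matrix ι ι ℝ} {F : ℝ → ℝ} (hF0 : F 0 = 0) {x : ℝ → ι → ℝ}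
    (hx : ∀ t, 0 ≤ t → HasDerivWithinAt x (feedbackField L F (x t)) (Set.Ici 0) t) {T : ℝ}
    (hT : 0 ≤ T) (h0 : ∀ t, T ≤ t → L *ᵥ x t = 0) {t : ℝ} (ht : T ≤ t) : x t = x T := by
  refine constant_of_has_deriv_right_zero (a := T) (b := t)
    (fun s hs => ((hx s (hT.trans hs.1)).continuousWithinAt).mono
      fun u hu => hT.trans hu.1) (fun s hs => ?_) t ⟨ht, le_rfl⟩
  have h := (hx s (hT.trans hs.1)).mono (Set.Ici_subset_Ici.2 (hT.trans hs.1))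
  have hz : feedbackField L F (x s) = 0 := by
    funext i
    simp [feedbackField, h0 s hs.1, hF0]
  rwa [hz] at h

end Settling

namespace SignedDigraph

open Matrix

variable {n : ℕ} {G : SignedDigraph n} {k₁ k₂ : ℝ} {m r p q : ℕ}

lemma isTrajectory_protocol_iff {x₀ : Fin n → ℝ} {x : ℝ → Fin n → ℝ} :
    IsTrajectory (G.protocol k₁ k₂ m r p q) x₀ x ↔ x 0 = x₀ ∧ ∀ t, 0 ≤ t →
      HasDerivWithinAt x (feedbackField G.mirror.laplacian (oddPowSum k₁ k₂ m r p q) (x t))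
        (Set.Ici 0) t := by
  have h : G.protocol k₁ k₂ m r p q =
      feedbackField G.mirror.laplacian (oddPowSum k₁ k₂ m r p q) := by
    funext x i
    simp only [protocol, mirrorFeedback_eq, feedbackField, oddPowSum]
  simp only [IsTrajectory, h, hasDerivWithinAt_pi]

lemma exists_isTrajectory_protocol (hk₁ : 0 < k₁) (hk₂ : 0 < k₂) (hm : 0 < m) (hr : 0 < r)
    (hp : 0 < p) (hq : 0 < q) (x₀ : Fin n → ℝ) :
    ∃ x, IsTrajectory (G.protocol k₁ k₂ m r p q) x₀ x := by
  simp only [isTrajectory_protocol_iff]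
  exact exists_hasDerivWithinAt_Ici_feedbackField G.posSemidef_mirror_laplacian
    (monotone_oddPowSum hk₁ hk₂ hm hr hp hq) (continuous_oddPowSum hm hr hp hq) oddPowSum_zero x₀

lemma isTrajectory_protocol_unique (hk₁ : 0 < k₁) (hk₂ : 0 < k₂) (hm : 0 < m) (hr : 0 < r)
    (hp : 0 < p) (hq : 0 < q) {x₀ : Fin n → ℝ} {x y : ℝ → Fin n → ℝ}
    (hx : IsTrajectory (G.protocol k₁ k₂ m r p q) x₀ x)
    (hy : IsTrajectory (G.protocol k₁ k₂ m r p q) x₀ y) {t : ℝ} (ht : 0 ≤ t) : x t = y t := by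
  rw [isTrajectory_protocol_iff] at hx hy
  exact eqOn_of_hasDerivWithinAt_feedbackField G.posSemidef_mirror_laplacian
    (monotone_oddPowSum hk₁ hk₂ hm hr hp hq)
    (fun s hs => (hx.2 s hs.1).mono Set.Icc_subset_Ici_self)
    (fun s hs => (hy.2 s hs.1).mono Set.Icc_subset_Ici_self)
    (hx.1.trans hy.1.symm) ⟨ht, le_rfl⟩

/-- The protocol does not see translations along the kernel of the mirror Laplacian. -/
lemma isTrajectory_protocol_add {x₀ v : Fin n → ℝ} (hv : G.mirror.laplacian *ᵥ v = 0)
    {x : ℝ → Fin n → ℝ} (hx : IsTrajectory (G.protocol k₁ k₂ m r p q) x₀ x) :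
    IsTrajectory (G.protocol k₁ k₂ m r p q) (x₀ + v) fun t => x t + v := by
  rw [isTrajectory_protocol_iff] at hx ⊢
  refine ⟨by rw [hx.1], fun t ht => ((hx.2 t ht).add_const v).congr_deriv ?_⟩
  funext i
  simp only [feedbackField, mulVec_add, hv, add_zero]

lemma settlesAt_of_eq {x₀ : Fin n → ℝ} {x : ℝ → Fin n → ℝ}
    (hx : IsTrajectory (G.protocol k₁ k₂ m r p q) x₀ x) {T : ℝ} (hT : 0 ≤ T) {y : Fin n → ℝ}
    (h : ∀ t, T ≤ t → x t = y) : SettlesAt x T y := fun i => by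
  refine ⟨?_, fun t ht => by rw [h t ht]⟩
  have := (hx.2 T hT i).continuousWithinAt.tendsto
  rwa [h T le_rfl] at this

end SignedDigraph

theorem theorem3 {n : ℕ} (hn : 2 ≤ n) (G : SignedDigraph n) (hG : G.StronglyConnected)
    (k₁ k₂ : ℝ) (hk₁ : 0 < k₁) (hk₂ : 0 < k₂)
    (m r p q : ℕ) (hm : Odd m) (hr : Odd r) (hp : Odd p) (hq : Odd q)
    (hrm : r < m) (hpq : p < q) :
    (G.StructurallyBalanced →
      ∃ T : ℝ, 0 ≤ T ∧
        T ≤ 1 / G.mirrorEigenvalue ⟨1, by omega⟩ *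
          ((n : ℝ) ^ (((m : ℝ) - r) / (2 * r)) / k₁ * ((r : ℝ) / ((m : ℝ) - r)) +
            1 / k₂ * ((q : ℝ) / ((q : ℝ) - p))) ∧
        FixedTimeBipartiteConsensus (G.protocol k₁ k₂ m r p q) T) ∧
    (G.StructurallyUnbalanced →
      ∃ T : ℝ, 0 ≤ T ∧
        T ≤ 1 / G.mirrorEigenvalue ⟨0, by omega⟩ *
          ((n : ℝ) ^ (((m : ℝ) - r) / (2 * r)) / k₁ * ((r : ℝ) / ((m : ℝ) - r)) +
            1 / k₂ * ((q : ℝ) / ((q : ℝ) - p))) ∧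
        FixedTimeStateStability (G.protocol k₁ k₂ m r p q) T) := by
  have : Nonempty (Fin n) := ⟨⟨0, by omega⟩⟩
  have hL := G.posSemidef_mirror_laplacian
  -- For a spectral gap `c` the settling time is the bound itself.
  have main : ∀ c : ℝ, 0 < c → (∀ x, c * energy G.mirror.laplacian x ≤
      (G.mirror.laplacian.mulVec x) ⬝ᵥ (G.mirror.laplacian.mulVec x)) →
      ∀ x₀ x, IsTrajectory (G.protocol k₁ k₂ m r p q) x₀ x →
      G.mirror.laplacian.mulVec (x (settlingBound c n k₁ k₂ m r p q)) = 0 ∧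
      ∀ t, settlingBound c n k₁ k₂ m r p q ≤ t →
        x t = x (settlingBound c n k₁ k₂ m r p q) := by
    intro c hc hgap x₀ x hx
    have hx' := (SignedDigraph.isTrajectory_protocol_iff.1 hx).2
    have hz : ∀ t, settlingBound c n k₁ k₂ m r p q ≤ t → G.mirror.laplacian.mulVec (x t) = 0 :=
      fun t ht => mulVec_eq_zero_of_settlingBound_le hL hc hgap hk₁ hk₂ hr.pos hp.pos hrm hpq hx'
        (by rwa [Fintype.card_fin])
    exact ⟨hz _ le_rfl, fun t ht => eq_of_mulVec_eq_zero oddPowSum_zero hx'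
      (settlingBound_nonneg hc n.cast_nonneg hk₁ hk₂ hrm hpq) hz ht⟩
  constructor
  · intro hb
    have hc := SignedDigraph.mirrorEigenvalue_one_pos_of_balanced hG hb hn
    have hT := settlingBound_nonneg hc n.cast_nonneg hk₁ hk₂ hrm hpq
    have hmain := main _ hc (SignedDigraph.mirrorEigenvalue_one_mul_energy_le hG hb hn)
    refine ⟨settlingBound (G.mirrorEigenvalue ⟨1, hn⟩) n k₁ k₂ m r p q, hT, le_rfl, ?_⟩
    set T := settlingBound (G.mirrorEigenvalue ⟨1, hn⟩) n k₁ k₂ m r p q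
    obtain ⟨σ, hσ, hσA⟩ := SignedDigraph.structurallyBalanced_iff.1 hb
    have hσL := SignedDigraph.mirror_laplacian_mulVec_sign hG hσ hσA
    choose X hX using fun x₀ => SignedDigraph.exists_isTrajectory_protocol (G := G) hk₁ hk₂ hm.pos
      hr.pos hp.pos hq.pos x₀
    have huniq : ∀ x₀ x, IsTrajectory (G.protocol k₁ k₂ m r p q) x₀ x → x T = X x₀ T :=
      fun x₀ x hx => SignedDigraph.isTrajectory_protocol_unique hk₁ hk₂ hm.pos hr.pos hp.pos hq.pos
        hx (hX x₀) hT
    set o : Fin n := ⟨0, by omega⟩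
    refine ⟨σ, fun x₀ => σ o * X x₀ T o, hσ, fun x₀ => ⟨⟨X x₀, hX x₀⟩, fun x hx => ?_⟩,
      fun x₀ => ?_⟩
    · refine SignedDigraph.settlesAt_of_eq hx hT fun t ht => ?_
      have h := hmain x₀ x hx
      rw [h.2 t ht, SignedDigraph.eq_smul_of_mirror_laplacian_mulVec_eq_zero hG hσ hσA h.1 o,
        huniq x₀ x hx]
      funext i
      simp [mul_comm]
    · have hshift : ∀ a : ℝ, σ o * X (x₀ + a • σ) T o = σ o * X x₀ T o + a := fun a => by
        have h := SignedDigraph.isTrajectory_protocol_add (v := a • σ)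
          (by rw [Matrix.mulVec_smul, hσL, smul_zero]) (hX x₀)
        rw [← huniq _ _ h]
        have hoo : σ o * σ o = 1 := by rcases hσ o with h | h <;> rw [h] <;> norm_num
        simp only [Pi.add_apply, Pi.smul_apply, smul_eq_mul]
        linear_combination a * hoo
      refine ⟨-(σ o * X x₀ T o), by simp only [hshift, add_neg_cancel], fun a ha => ?_⟩
      simp only [hshift] at ha
      linarith
  · intro hub
    have hn0 : 0 < n := by omega
    have hc := SignedDigraph.mirrorEigenvalue_zero_pos_of_unbalanced hG hub hn0
    have hT := settlingBound_nonneg hc n.cast_nonneg hk₁ hk₂ hrm hpq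
    have hmain := main _ hc (SignedDigraph.mirrorEigenvalue_zero_mul_energy_le G hn0)
    refine ⟨settlingBound (G.mirrorEigenvalue ⟨0, hn0⟩) n k₁ k₂ m r p q, hT, le_rfl, fun x₀ =>
      ⟨SignedDigraph.exists_isTrajectory_protocol hk₁ hk₂ hm.pos hr.pos hp.pos hq.pos x₀,
        fun x hx => SignedDigraph.settlesAt_of_eq hx hT fun t ht => ?_⟩⟩
    have h := hmain x₀ x hx
    rw [h.2 t ht]
    exact SignedDigraph.eq_zero_of_mirror_laplacian_mulVec_eq_zero hG hub h.1
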